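/- Let $n\in\mathbb N$, $k\ge 1$ an integer, $h>0$, $X_{\mathbb R}=C([-h,0],\mathbb R^n)$ with the supremum norm, and let $F:X_{\mathbb R}\to\mathbb R^n$ be of class $C^{k+1}$. For a continuous function $x$ on $\mathbb R$ put $x_t(\theta)=x(t+\theta)$, $\theta\in[-h,0]$. Let $\gamma:\mathbb R\to\mathbb R^n$ be a $T$-periodic solution of $\dot x(t)=F(x_t)$, where $T>0$ is the minimal positive number with $\gamma_T=\gamma_0$. Let $L(t)=DF(\gamma_t)$, complexified to an operator from $X=C([-h,0],\mathbb C^n)$ to $\mathbb C^n$, and let $U(t,s)\in\mathcal L(X)$, $t\ge s$, be defined by $U(t,s)\varphi=y_t$, where $y$ is the solution of $\dot y(t)=L(t)y_t$ $(t\ge s)$, $y_s=\varphi$. Let $A(\tau)$ be the operator in $X$ with domain $\{\varphi\in C^1([-h,0],\mathbb C^n):\dot\varphi(0)=L(\tau)\varphi\}$ and $A(\tau)\varphi=\dot\varphi$. Let $T_0$ be the shift semigroup on $X$, $(T_0(t)\varphi)(\theta)=\varphi(\min(t+\theta,0))$; let $X^{\odot}=\{x^\star\in X^\star: t\mapsto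 x^\star\circ T_0(t)\text{ is norm continuous on }[0,\infty)\}$, $X^{\odot\star}=(X^\odot)^\star$, and let $j:X\to X^{\odot\star}$ be the canonical embedding $\langle j\varphi,x^\odot\rangle=\langle x^\odot,\varphi\rangle$. Let $A^{\odot}(\tau)$ be the part of $A(\tau)^\star$ in $X^\odot$ and $A^{\odot\star}(\tau)=(A^\odot(\tau))^\star$. Let $\lambda$ be a Floquet multiplier, i.e. $0\ne\lambda\in\sigma(U(s+T,s))$ for some $s\in\mathbb R$, and let $\sigma\in\mathbb C$ be a Floquet exponent of it, i.e. $e^{\sigma T}=\lambda$. For $\tau\in\mathbb R$ let $E_\lambda(\tau)=\bigcup_{l\ge 1}\mathcal N\big((\lambda I-U(\tau+T,\tau))^l\big)$ be the generalized eigenspace, $m_\lambda=\dim E_\lambda(s)$ the algebraic multiplicity and $g_\lambda=\dim\mathcal N(\lambda I-U(s+T,s))$ the geometric multiplicity of $\lambda$. Theorem. There exist $T$-periodic maps $\varphi_0,\dots,\varphi_{m_\lambda-1}:\mathbb R\to X$ of class $C^{k+1}$ and a set $H\subseteq\{0,\dots,m_\lambda-1\}$ of exactly $g_\lambda$ indices,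 containing $0$, such that, for all $\tau\in\mathbb R$ and all $i$, $\varphi_i(\tau)$ lies in the domain of $A(\tau)$, $j\varphi_i(\tau)$ lies in the domain of $A^{\odot\star}(\tau)$, $$\Big(\frac{d}{d\tau}-A^{\odot\star}(\tau)+\sigma\Big)j\varphi_i(\tau)=\begin{cases}0,& i\in H,\\ -j\varphi_{i-1}(\tau),& i\notin H,\end{cases}\qquad(1)$$ $$\Big(\frac{d}{d\tau}-A(\tau)+\sigma\Big)\varphi_i(\tau)=\begin{cases}0,& i\in H,\\ -\varphi_{i-1}(\tau),& i\notin H,\end{cases}\qquad(2)$$ and such that $(\varphi_0(\tau),\dots,\varphi_{m_\lambda-1}(\tau))$ is an ordered basis of $E_\lambda(\tau)$ for every $\tau\in\mathbb R$. In particular, if $E_\lambda(s)$ is spanned by a single Jordan chain ($g_\lambda=1$), then $H=\{0\}$: the right-hand sides are $0$ for $i=0$ and $-j\varphi_{i-1}(\tau)$, respectively $-\varphi_{i-1}(\tau)$, for $i=1,\dots,m_\lambda-1$. Moreover, (1) and (2) are equivalent: for every set $H\subseteq\{0,\dots,m_\lambda-1\}$ containing $0$ (if $m_\lambda\geq 1$)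 and all $T$-periodic $C^{k+1}$ maps $\varphi_0,\dots,\varphi_{m_\lambda-1}:\mathbb R\to X$, the system (1) holds for all $i$ and $\tau$ if and only if the system (2) does. -/

import Mathlib

open Set Filter Topology
namespace DelayEq

noncomputable section

/-- The history space `C([-h, 0], V)` with the supremum norm. -/
abbrev HistorySpace (h : ℝ) (V : Type*) [TopologicalSpace V] : Type _ :=
  C(Set.Icc (-h) (0 : ℝ), V)

instance fact_neg_le {h : ℝ} [hh : Fact (0 < h)] : Fact (-h ≤ (0 : ℝ)) :=
  ⟨by have := hh.out; linarith⟩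

/-- The point `0` of `[-h, 0]`. -/
def zeroPt (h : ℝ) [hh : Fact (0 < h)] : Set.Icc (-h) (0 : ℝ) :=
  ⟨0, by have := hh.out; constructor <;> linarith⟩

/-- The history `x_t(θ) = x(t + θ)`, `θ ∈ [-h, 0]`, of `x` at time `t`. -/
def hist {V : Type*} [TopologicalSpace V] (h : ℝ) (x : C(ℝ, V)) (t : ℝ) : HistorySpace h V :=
  ⟨fun θ => x (t + (θ : ℝ)), by fun_prop⟩

theorem hist_continuous {V : Type*} [TopologicalSpace V] {h : ℝ} (y : C(ℝ, V)) : Continuous (hist h y) := by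
  apply ContinuousMap.continuous_of_continuous_uncurry
  show Continuous fun p : ℝ × Set.Icc (-h) (0 : ℝ) => y (p.1 + (p.2 : ℝ))
  fun_prop

section Evolution

variable {V : Type*} [NormedAddCommGroup V] [NormedSpace ℂ V] {h : ℝ}

/-- `y` solves the linear delay equation `y'(t) = L(t) y_t` for `t ≥ s`, with `y_s = φ`.
(Only the values of `y` on `[s - h, ∞)` matter.) -/
structure IsSolution (L : ℝ → HistorySpace h V →L[ℂ] V) (s : ℝ) (φ : HistorySpace h V)
    (y : C(ℝ, V)) : Prop where
  init : hist h y s = φ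
  eqn : ∀ t, s ≤ t → HasDerivWithinAt y (L t (hist h y t)) (Ici s) t

/-- `U` is the solution operator from time `s` to time `t` of `y'(t) = L(t) y_t`. -/
def IsEvolutionOperator (L : ℝ → HistorySpace h V →L[ℂ] V) (s t : ℝ)
    (U : HistorySpace h V →L[ℂ] HistorySpace h V) : Prop :=
  ∀ φ, ∃ y : C(ℝ, V), IsSolution L s φ y ∧ U φ = hist h y t

theorem solution_unique [Fact (0 < h)] {L : ℝ → HistorySpace h V →L[ℂ] V} {M : ℝ}
    (hM : ∀ t, ‖L t‖ ≤ M) {s t : ℝ} (hst : s ≤ t) {φ : HistorySpace h V} {y z : C(ℝ, V)}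
    (hy : IsSolution L s φ y) (hz : IsSolution L s φ z) : hist h y t = hist h z t := by
  have hM0 : 0 ≤ M := (norm_nonneg (L 0)).trans (hM 0)
  set κ : ℝ := M + 1 with hκ
  have hκ0 : 0 < κ := by linarith
  set u : C(ℝ, V) := y - z with hu
  have hu_hist : ∀ τ, hist h u τ = hist h y τ - hist h z τ := fun τ => by
    ext θ; simp [hist, hu]
  have hu0 : ∀ x ∈ Icc (s - h) s, u x = 0 := by
    intro x hx
    have := congrArg (fun f => f ⟨x - s, by constructor <;> linarith [hx.1, hx.2]⟩)
      ((hu_hist s).trans (by rw [hy.init, hz.init, sub_self]))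
    simpa [hist] using this
  have hder : ∀ τ, s ≤ τ → HasDerivWithinAt u (L τ (hist h u τ)) (Ici s) τ := by
    intro τ hτ
    rw [hu_hist, map_sub]
    exact (hy.eqn τ hτ).sub (hz.eqn τ hτ)
  obtain ⟨x₀, hx₀, hmax⟩ := (isCompact_Icc (a := s - h) (b := t)).exists_isMaxOn
    (f := fun x => Real.exp (-κ * (x - s)) * ‖u x‖)
    ⟨t, by have := (Fact.out : 0 < h); constructor <;> linarith⟩ (by fun_prop)
  set N : ℝ := Real.exp (-κ * (x₀ - s)) * ‖u x₀‖ with hN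
  have hN0 : 0 ≤ N := by positivity
  have hb : ∀ x ∈ Icc (s - h) t, ‖u x‖ ≤ N * Real.exp (κ * (x - s)) := by
    intro x hx
    have h1 : Real.exp (-κ * (x - s)) * ‖u x‖ ≤ N := hmax hx
    have h2 : Real.exp (-κ * (x - s)) * Real.exp (κ * (x - s)) = 1 := by
      rw [← Real.exp_add]; simp
    calc ‖u x‖ = Real.exp (-κ * (x - s)) * ‖u x‖ * Real.exp (κ * (x - s)) := by
          rw [mul_right_comm, h2, one_mul]
      _ ≤ _ := by gcongr
  have hb2 : ∀ τ ∈ Icc s t, ‖hist h u τ‖ ≤ N * Real.exp (κ * (τ - s)) := by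
    intro τ hτ
    rw [ContinuousMap.norm_le _ (by positivity)]
    intro θ
    refine (hb (τ + θ) ⟨by linarith [hτ.1, θ.2.1], by linarith [hτ.2, θ.2.2]⟩).trans ?_
    gcongr
    linarith [θ.2.2]
  have hfin : ∀ x ∈ Icc s t, ‖u x‖ ≤ N * (M / κ) * Real.exp (κ * (x - s)) := by
    refine image_norm_le_of_norm_deriv_right_le_deriv_boundary
      (f := u) (f' := fun τ => L τ (hist h u τ))
      (B := fun x => N * (M / κ) * Real.exp (κ * (x - s)))
      (B' := fun x => N * (M / κ) * (Real.exp (κ * (x - s)) * κ)) ?_ ?_ ?_ ?_ ?_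
    · fun_prop
    · intro x hx
      exact (hder x hx.1).mono (Ici_subset_Ici.2 hx.1)
    · rw [hu0 s ⟨by have := (Fact.out : 0 < h); linarith, le_rfl⟩]
      simp; positivity
    · intro x
      have : HasDerivAt (fun x => κ * (x - s)) κ x := by
        simpa using ((hasDerivAt_id x).sub_const s).const_mul κ
      exact this.exp.const_mul _
    · intro x hx
      calc ‖L x (hist h u x)‖ ≤ M * (N * Real.exp (κ * (x - s))) :=
            (L x).le_of_opNorm_le_of_le (hM x) (hb2 x ⟨hx.1, hx.2.le⟩)
        _ = _ := by field_simp
  have hNz : N = 0 := by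
    rcases le_total x₀ s with hx | hx
    · rw [hN, hu0 x₀ ⟨hx₀.1, hx⟩]; simp
    · have h1 := hfin x₀ ⟨hx, hx₀.2⟩
      have h2 : Real.exp (-κ * (x₀ - s)) * Real.exp (κ * (x₀ - s)) = 1 := by
        rw [← Real.exp_add]; simp
      have h3 : N ≤ N * (M / κ) := by
        calc N ≤ Real.exp (-κ * (x₀ - s)) * (N * (M / κ) * Real.exp (κ * (x₀ - s))) := by
              rw [hN] at h1 ⊢; gcongr
          _ = N * (M / κ) * (Real.exp (-κ * (x₀ - s)) * Real.exp (κ * (x₀ - s))) := by ring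
          _ = _ := by rw [h2, mul_one]
      have h4 : M / κ < 1 := by rw [div_lt_one hκ0]; linarith
      nlinarith
  rw [← sub_eq_zero, ← hu_hist]
  have := hb2 t ⟨hst, le_rfl⟩
  rw [hNz, zero_mul] at this
  exact norm_le_zero_iff.1 this


open scoped BoundedContinuousFunction

/-- Multiplication by the weight `exp (κ (t - s)⁺)`. -/
def weighted (κ s : ℝ) (z : ℝ →ᵇ V) : C(ℝ, V) :=
  ⟨fun t => ((Real.exp (κ * max (t - s) 0) : ℝ) : ℂ) • z t, by fun_prop⟩

theorem weighted_hist_norm {κ s : ℝ} (hκ : 0 ≤ κ) (z : ℝ →ᵇ V) (τ : ℝ) :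
    ‖hist h (weighted κ s z) τ‖ ≤ Real.exp (κ * max (τ - s) 0) * ‖z‖ := by
  rw [ContinuousMap.norm_le _ (by positivity)]
  intro θ
  show ‖((Real.exp (κ * max (τ + θ - s) 0) : ℝ) : ℂ) • z (τ + θ)‖ ≤ _
  rw [norm_smul, Complex.norm_real, Real.norm_of_nonneg (Real.exp_pos _).le]
  gcongr
  · linarith [θ.2.2]
  · exact z.norm_coe_le_norm _

theorem continuous_integrand {L : ℝ → HistorySpace h V →L[ℂ] V} (hL : Continuous L)
    (y : C(ℝ, V)) : Continuous fun τ => L τ (hist h y τ) :=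
  hL.clm_apply (hist_continuous y)

theorem volterra_bound {L : ℝ → HistorySpace h V →L[ℂ] V} {M : ℝ}
    (hM : ∀ t, ‖L t‖ ≤ M) (s : ℝ) (z : ℝ →ᵇ V) (t : ℝ) :
    ‖((Real.exp (-((M + 1) * max (t - s) 0)) : ℝ) : ℂ) •
      ∫ τ in s..max s t, L τ (hist h (weighted (M + 1) s z) τ)‖ ≤ M / (M + 1) * ‖z‖ := by
  have hM0 : 0 ≤ M := (norm_nonneg (L 0)).trans (hM 0)
  set κ : ℝ := M + 1 with hκ
  have hκ0 : 0 < κ := by linarith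
  have hst : s ≤ max s t := le_max_left _ _
  have hmx : max (t - s) 0 = max s t - s := by
    rcases le_total s t with h1 | h1
    · rw [max_eq_left (by linarith), max_eq_right h1]
    · rw [max_eq_right (by linarith), max_eq_left h1]; ring
  have h1 : ‖∫ τ in s..max s t, L τ (hist h (weighted κ s z) τ)‖ ≤
      ∫ τ in s..max s t, M * ‖z‖ * Real.exp (κ * (τ - s)) := by
    apply intervalIntegral.norm_integral_le_of_norm_le hst
    · refine Filter.Eventually.of_forall fun τ hτ => ?_
      refine ((L τ).le_of_opNorm_le_of_le (hM τ)
        (weighted_hist_norm (s := s) hκ0.le z τ)).trans ?_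
      rw [max_eq_left (by linarith [hτ.1] : (0:ℝ) ≤ τ - s)]
      apply le_of_eq; ring
    · exact (by fun_prop : Continuous _).intervalIntegrable _ _
  have h2 : ∫ τ in s..max s t, M * ‖z‖ * Real.exp (κ * (τ - s)) =
      M * ‖z‖ * (Real.exp (κ * (max s t - s)) / κ) - M * ‖z‖ * (1 / κ) := by
    rw [intervalIntegral.integral_eq_sub_of_hasDerivAt
      (f := fun τ => M * ‖z‖ * (Real.exp (κ * (τ - s)) / κ))]
    · simp
    · intro x _
      have : HasDerivAt (fun x => κ * (x - s)) κ x := by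
        simpa using ((hasDerivAt_id x).sub_const s).const_mul κ
      have := ((this.exp).div_const κ).const_mul (M * ‖z‖)
      rwa [mul_div_cancel_right₀ _ hκ0.ne'] at this
    · exact (by fun_prop : Continuous _).intervalIntegrable _ _
  rw [norm_smul, Complex.norm_real, Real.norm_of_nonneg (Real.exp_pos _).le, hmx]
  have h3 : Real.exp (-(κ * (max s t - s))) * Real.exp (κ * (max s t - s)) = 1 := by
    rw [← Real.exp_add]; simp
  calc Real.exp (-(κ * (max s t - s))) * ‖∫ τ in s..max s t, L τ (hist h (weighted κ s z) τ)‖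
      ≤ Real.exp (-(κ * (max s t - s))) * (M * ‖z‖ * (Real.exp (κ * (max s t - s)) / κ)) := by
        gcongr
        refine (h1.trans h2.le).trans ?_
        have : 0 ≤ M * ‖z‖ * (1 / κ) := by positivity
        linarith
    _ = (Real.exp (-(κ * (max s t - s))) * Real.exp (κ * (max s t - s))) * (M / κ * ‖z‖) := by
        ring
    _ = _ := by rw [h3, one_mul]

/-- The weighted Volterra operator, a strict contraction. -/
def volterra {L : ℝ → HistorySpace h V →L[ℂ] V} (hL : Continuous L) {M : ℝ}
    (hM : ∀ t, ‖L t‖ ≤ M) (s : ℝ) : (ℝ →ᵇ V) →L[ℂ] (ℝ →ᵇ V) :=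
  LinearMap.mkContinuous
    { toFun := fun z => BoundedContinuousFunction.ofNormedAddCommGroup
        (fun t => ((Real.exp (-((M + 1) * max (t - s) 0)) : ℝ) : ℂ) •
          ∫ τ in s..max s t, L τ (hist h (weighted (M + 1) s z) τ))
        (by
          have h1 : Continuous fun t : ℝ => ∫ τ in s..t, L τ (hist h (weighted (M + 1) s z) τ) :=
            intervalIntegral.continuous_primitive
              (fun a b => (continuous_integrand hL _).intervalIntegrable a b) s
          have h2 := h1.comp (continuous_const.max continuous_id : Continuous fun t : ℝ => max s t)
          exact (by fun_prop : Continuous fun t : ℝ =>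
            ((Real.exp (-((M + 1) * max (t - s) 0)) : ℝ) : ℂ)).smul h2)
        (M / (M + 1) * ‖z‖) (volterra_bound hM s z)
      map_add' := fun z w => by
        ext t
        have h1 : ∀ τ, hist h (weighted (M + 1) s (z + w)) τ =
            hist h (weighted (M + 1) s z) τ + hist h (weighted (M + 1) s w) τ := fun τ => by
          ext θ; simp [hist, weighted]
        simp only [BoundedContinuousFunction.coe_ofNormedAddCommGroup,
          BoundedContinuousFunction.coe_add, Pi.add_apply, h1, map_add]
        rw [intervalIntegral.integral_add
          ((continuous_integrand hL _).intervalIntegrable _ _)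
          ((continuous_integrand hL _).intervalIntegrable _ _), smul_add]
      map_smul' := fun c z => by
        ext t
        have h1 : ∀ τ, hist h (weighted (M + 1) s (c • z)) τ =
            c • hist h (weighted (M + 1) s z) τ := fun τ => by
          ext θ; simp [hist, weighted, smul_comm c]
        simp only [BoundedContinuousFunction.coe_ofNormedAddCommGroup,
          BoundedContinuousFunction.coe_smul, h1, map_smul, RingHom.id_apply]
        rw [intervalIntegral.integral_smul, smul_comm] }
    (M / (M + 1)) (fun z => by
      have hM0 : 0 ≤ M := (norm_nonneg (L 0)).trans (hM 0)
      exact BoundedContinuousFunction.norm_ofNormedAddCommGroup_le _ (by positivity)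
        (volterra_bound hM s z))

theorem volterra_norm_lt {L : ℝ → HistorySpace h V →L[ℂ] V} (hL : Continuous L) {M : ℝ}
    (hM : ∀ t, ‖L t‖ ≤ M) (s : ℝ) : ‖volterra hL hM s‖ < 1 := by
  have hM0 : 0 ≤ M := (norm_nonneg (L 0)).trans (hM 0)
  refine (LinearMap.mkContinuous_norm_le _ (by positivity) _).trans_lt ?_
  rw [div_lt_one (by linarith)]; linarith

theorem extend_bound [Fact (0 < h)] {κ : ℝ} (s : ℝ) (hκ : 0 ≤ κ) (φ : HistorySpace h V) (t : ℝ) :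
    ‖((Real.exp (-(κ * max (t - s) 0)) : ℝ) : ℂ) • ContinuousMap.IccExtendCM φ (t - s)‖ ≤ ‖φ‖ := by
  rw [norm_smul, Complex.norm_real, Real.norm_of_nonneg (Real.exp_pos _).le]
  have h1 : Real.exp (-(κ * max (t - s) 0)) ≤ 1 := by
    rw [Real.exp_le_one_iff]
    have := mul_nonneg hκ (le_max_right (t - s) 0)
    linarith
  have h2 : ‖ContinuousMap.IccExtendCM φ (t - s)‖ ≤ ‖φ‖ := φ.norm_coe_le_norm _
  exact (mul_le_of_le_one_left (norm_nonneg _) h1).trans h2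

/-- The weighted extension of an initial function by its end values. -/
def extend [Fact (0 < h)] (κ s : ℝ) (hκ : 0 ≤ κ) : HistorySpace h V →L[ℂ] (ℝ →ᵇ V) :=
  LinearMap.mkContinuous
    { toFun := fun φ => BoundedContinuousFunction.ofNormedAddCommGroup
        (fun t => ((Real.exp (-(κ * max (t - s) 0)) : ℝ) : ℂ) •
          ContinuousMap.IccExtendCM φ (t - s))
        (by fun_prop) ‖φ‖ (extend_bound s hκ φ)
      map_add' := fun φ ψ => by
        ext t; simp [ContinuousMap.IccExtendCM]
      map_smul' := fun c φ => by
        ext t; simp [ContinuousMap.IccExtendCM, smul_comm c] }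
    1 (fun φ => by
      rw [one_mul]
      exact BoundedContinuousFunction.norm_ofNormedAddCommGroup_le _ (norm_nonneg _)
        (extend_bound s hκ φ))

/-- Removal of the weight and restriction to the history at time `t`. -/
def restrict (h κ s t : ℝ) (hκ : 0 ≤ κ) : (ℝ →ᵇ V) →L[ℂ] HistorySpace h V :=
  LinearMap.mkContinuous
    { toFun := fun z => hist h (weighted κ s z) t
      map_add' := fun z w => by ext θ; simp [hist, weighted]
      map_smul' := fun c z => by ext θ; simp [hist, weighted, smul_comm c] }
    (Real.exp (κ * max (t - s) 0)) (fun z => weighted_hist_norm hκ z t)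

theorem exists_evolutionOperator [CompleteSpace V] [Fact (0 < h)]
    {L : ℝ → HistorySpace h V →L[ℂ] V} (hL : Continuous L) {M : ℝ} (hM : ∀ t, ‖L t‖ ≤ M)
    (s t : ℝ) : ∃ U, IsEvolutionOperator L s t U := by
  have hM0 : 0 ≤ M := (norm_nonneg (L 0)).trans (hM 0)
  have hκ : 0 ≤ M + 1 := by linarith
  set W := volterra hL hM s with hW
  set R := Units.oneSub W (volterra_norm_lt hL hM s) with hR
  refine ⟨restrict h (M + 1) s t hκ ∘L (↑R⁻¹ : (ℝ →ᵇ V) →L[ℂ] (ℝ →ᵇ V)) ∘L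
    extend (M + 1) s hκ, fun φ => ?_⟩
  set z : ℝ →ᵇ V := (↑R⁻¹ : (ℝ →ᵇ V) →L[ℂ] (ℝ →ᵇ V)) (extend (M + 1) s hκ φ) with hz
  have hz1 : z - W z = extend (M + 1) s hκ φ := by
    have h1 : (R : (ℝ →ᵇ V) →L[ℂ] (ℝ →ᵇ V)) z = extend (M + 1) s hκ φ := by
      rw [hz, ← mul_apply_eq_comp, Units.mul_inv]; rfl
    rw [← h1, hR, Units.val_oneSub]; rfl
  refine ⟨weighted (M + 1) s z, ?_, rfl⟩
  have hy : ∀ x, weighted (M + 1) s z x = ContinuousMap.IccExtendCM φ (x - s) +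
      ∫ τ in s..max s x, L τ (hist h (weighted (M + 1) s z) τ) := by
    intro x
    have h1 : z x = extend (M + 1) s hκ φ x + W z x := by
      rw [← hz1]; simp
    have h2 : ((Real.exp ((M + 1) * max (x - s) 0) : ℝ) : ℂ) *
        ((Real.exp (-((M + 1) * max (x - s) 0)) : ℝ) : ℂ) = 1 := by
      rw [← Complex.ofReal_mul, ← Real.exp_add]; simp
    show ((Real.exp ((M + 1) * max (x - s) 0) : ℝ) : ℂ) • z x = _
    rw [h1]
    show ((Real.exp ((M + 1) * max (x - s) 0) : ℝ) : ℂ) •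
      (((Real.exp (-((M + 1) * max (x - s) 0)) : ℝ) : ℂ) • ContinuousMap.IccExtendCM φ (x - s) +
      ((Real.exp (-((M + 1) * max (x - s) 0)) : ℝ) : ℂ) •
        ∫ τ in s..max s x, L τ (hist h (weighted (M + 1) s z) τ)) = _
    rw [smul_add, smul_smul, smul_smul, h2, one_smul, one_smul]
  constructor
  · ext θ
    show weighted (M + 1) s z (s + θ) = φ θ
    rw [hy, max_eq_left (by linarith [θ.2.2]), intervalIntegral.integral_same, add_zero,
      add_sub_cancel_left]
    exact ContinuousMap.IccExtendCM_of_mem θ.2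
  · intro x hx
    have hF : HasDerivAt (fun x => φ (zeroPt h) +
        ∫ τ in s..x, L τ (hist h (weighted (M + 1) s z) τ))
        (L x (hist h (weighted (M + 1) s z) x)) x := by
      have hc := continuous_integrand hL (weighted (M + 1) s z)
      exact (intervalIntegral.integral_hasDerivAt_right (hc.intervalIntegrable _ _)
        (hc.stronglyMeasurableAtFilter _ _) hc.continuousAt).const_add _
    refine hF.hasDerivWithinAt.congr_of_mem (fun w hw => ?_) hx
    have hw' : s ≤ w := hw
    rw [hy, max_eq_right hw']
    congr 1
    show φ (projIcc (-h) 0 (Fact.out : -h ≤ (0 : ℝ)) (w - s)) = _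
    rw [projIcc_of_right_le _ (by linarith)]
    rfl

theorem evolutionOperator_unique [Fact (0 < h)]
    {L : ℝ → HistorySpace h V →L[ℂ] V} {M : ℝ} (hM : ∀ t, ‖L t‖ ≤ M) {s t : ℝ} (hst : s ≤ t)
    {U U' : HistorySpace h V →L[ℂ] HistorySpace h V} (hU : IsEvolutionOperator L s t U)
    (hU' : IsEvolutionOperator L s t U') : U = U' := by
  ext1 φ
  obtain ⟨y, hy, hUy⟩ := hU φ
  obtain ⟨z, hz, hUz⟩ := hU' φ
  rw [hUy, hUz, solution_unique hM hst hy hz]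

/-- The forward evolutionary system `U(t, s)`, `t ≥ s`: `U(t, s) φ = y_t` for the solution `y` of
`y'(t) = L(t) y_t` with `y_s = φ`. For bounded continuous `L` it exists and is unique by
`exists_evolutionOperator` and `evolutionOperator_unique`. -/
def evolution (L : ℝ → HistorySpace h V →L[ℂ] V) (t s : ℝ) :
    HistorySpace h V →L[ℂ] HistorySpace h V :=
  Classical.epsilon (IsEvolutionOperator L s t)

theorem evolution_spec [CompleteSpace V] [Fact (0 < h)]
    {L : ℝ → HistorySpace h V →L[ℂ] V} (hL : Continuous L) {M : ℝ} (hM : ∀ t, ‖L t‖ ≤ M)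
    (t s : ℝ) : IsEvolutionOperator L s t (evolution L t s) :=
  Classical.epsilon_spec (exists_evolutionOperator hL hM s t)

end Evolution

section SunStar

/-- The shift semigroup: `(T₀(t) φ)(θ) = φ(t + θ)` if `t + θ ≤ 0`, and `φ(0)` if `t + θ ≥ 0`
(for `t ≥ 0`; the maximum with `-h` is then inactive). -/
def shiftSemigroup (h : ℝ) (V : Type*) [NormedAddCommGroup V] [NormedSpace ℂ V] (t : ℝ) :
    HistorySpace h V →L[ℂ] HistorySpace h V where
  toFun φ := φ.comp ⟨fun θ => ⟨max (-h) (min (t + (θ : ℝ)) 0), le_max_left _ _,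
    max_le (θ.2.1.trans θ.2.2) (min_le_right _ _)⟩, by fun_prop⟩
  map_add' _ _ := rfl
  map_smul' _ _ := rfl
  cont := ContinuousMap.continuous_precomp _

variable {E : Type*} [NormedAddCommGroup E] [NormedSpace ℂ E]

/-- The functionals `x` for which `t ↦ S(t)^⋆ x = x ∘ S(t)` is norm continuous on `[0, ∞)`. -/
def sunSubmodule (S : ℝ → E →L[ℂ] E) : Submodule ℂ (StrongDual ℂ E) where
  carrier := {x | ContinuousOn (fun t => (x.comp (S t) : StrongDual ℂ E)) (Ici (0 : ℝ))}
  zero_mem' := by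
    simpa using continuousOn_const
  add_mem' hx hy := (ContinuousOn.add hx hy).congr fun _ _ => ContinuousLinearMap.add_comp _ _ _
  smul_mem' c _ hx := (ContinuousOn.const_smul hx c).congr fun _ _ => rfl

/-- The sun dual `E^⊙` of `E` with respect to the semigroup `S`, with the norm of `E^⋆`. -/
def SunDual (S : ℝ → E →L[ℂ] E) : Type _ := ↥(sunSubmodule S)

instance (S : ℝ → E →L[ℂ] E) : NormedAddCommGroup (SunDual S) :=
  inferInstanceAs (NormedAddCommGroup ↥(sunSubmodule S))

instance (S : ℝ → E →L[ℂ] E) : NormedSpace ℂ (SunDual S) :=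
  inferInstanceAs (NormedSpace ℂ ↥(sunSubmodule S))

/-- The inclusion `E^⊙ → E^⋆`. -/
def sunInclusion (S : ℝ → E →L[ℂ] E) : SunDual S →L[ℂ] StrongDual ℂ E :=
  (sunSubmodule S).subtypeL

/-- The sun-star dual `E^⊙⋆ = (E^⊙)^⋆`. -/
abbrev SunStar (S : ℝ → E →L[ℂ] E) : Type _ := StrongDual ℂ (SunDual S)

/-- The canonical embedding `j : E → E^⊙⋆`, `⟨jφ, x⟩ = ⟨x, φ⟩`. -/
def sunEmbedding (S : ℝ → E →L[ℂ] E) : E →L[ℂ] SunStar S :=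
  ContinuousLinearMap.flip (sunInclusion S)

end SunStar

section Generators

/-! Unbounded operators are given by their graphs: `(x, y) ∈ G` means that `x` belongs to the
domain and is mapped to `y`. -/

/-- The graph of the (Banach space) adjoint of the operator with graph `G`. -/
def adjointGraph {E : Type*} [NormedAddCommGroup E] [NormedSpace ℂ E] (G : Submodule ℂ (E × E)) :
    Submodule ℂ (StrongDual ℂ E × StrongDual ℂ E) where
  carrier := {p | ∀ q ∈ G, p.2 q.1 = p.1 q.2}
  zero_mem' := fun q _ => by simp
  add_mem' {a b} ha hb := fun q hq => by simp [ha q hq, hb q hq]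
  smul_mem' c a ha := fun q hq => by simp [ha q hq]

variable {h : ℝ} {V : Type*} [NormedAddCommGroup V] [NormedSpace ℂ V]

/-- The graph of the generator `A`: its domain consists of the `C¹` functions `φ` with
`φ'(0) = ℓ φ`, and `A φ = φ'`. -/
def generator [Fact (0 < h)] (ℓ : HistorySpace h V →L[ℂ] V) :
    Submodule ℂ (HistorySpace h V × HistorySpace h V) where
  carrier := {p | (∀ θ : Icc (-h) (0 : ℝ), HasDerivWithinAt (ContinuousMap.IccExtendCM p.1)
    (p.2 θ) (Icc (-h) 0) θ) ∧ p.2 (zeroPt h) = ℓ p.1}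
  zero_mem' := by
    refine ⟨fun θ => ?_, by simp⟩
    have : (ContinuousMap.IccExtendCM (0 : HistorySpace h V) : ℝ → V) = fun _ => 0 := by
      ext; simp [ContinuousMap.IccExtendCM]
    show HasDerivWithinAt (ContinuousMap.IccExtendCM (0 : HistorySpace h V)) 0 _ _
    rw [this]
    exact hasDerivWithinAt_const _ _ _
  add_mem' {a b} ha hb :=
    ⟨fun θ => (ha.1 θ).add (hb.1 θ), by simp [ha.2, hb.2]⟩
  smul_mem' c a ha :=
    ⟨fun θ => (ha.1 θ).const_smul c, by simp [ha.2]⟩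

/-- The graph of the sun generator `A^⊙`: the part of `A^⋆` in the sun dual `X^⊙` of `X` with
respect to the shift semigroup. -/
def sunGenerator [Fact (0 < h)] (ℓ : HistorySpace h V →L[ℂ] V) :
    Submodule ℂ (SunDual (shiftSemigroup h V) × SunDual (shiftSemigroup h V)) :=
  (adjointGraph (generator ℓ)).comap
    ((sunInclusion (shiftSemigroup h V)).toLinearMap.prodMap
      (sunInclusion (shiftSemigroup h V)).toLinearMap)

/-- The graph of the sun-star generator `A^⊙⋆ = (A^⊙)^⋆`. -/
def sunStarGenerator [Fact (0 < h)] (ℓ : HistorySpace h V →L[ℂ] V) :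
    Submodule ℂ (SunStar (shiftSemigroup h V) × SunStar (shiftSemigroup h V)) :=
  adjointGraph (sunGenerator ℓ)

end Generators

section AbstractODE

variable {E : Type*} [NormedAddCommGroup E] [NormedSpace ℂ E]

/-- `u ∈ C_T^l(ℝ, E)`. -/
def IsSmoothPeriodic (l : ℕ) (T : ℝ) (u : ℝ → E) : Prop :=
  ContDiff ℝ l u ∧ Function.Periodic u T

/-- `(d/dτ - A(τ) + σ) u(τ) = g(τ)` for all `τ`, where `A(τ)` is given by its graph. -/
def SolvesAbstractODE (A : ℝ → Submodule ℂ (E × E)) (σ : ℂ) (u g : ℝ → E) : Prop :=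
  ∀ τ, ∃ u' Au : E, HasDerivAt u u' τ ∧ (u τ, Au) ∈ A τ ∧ u' - Au + σ • u τ = g τ

/-- The right-hand sides `0` for `i ∈ heads` and `-u_{i-1}` for all other `i`. -/
def chainRHS {m : ℕ} (heads : Finset (Fin m)) (u : Fin m → ℝ → E) (i : Fin m) (τ : ℝ) : E :=
  if i ∈ heads then 0 else -u ⟨i - 1, (Nat.sub_le _ _).trans_lt i.2⟩ τ

/-- The system `(d/dτ - A(τ) + σ) u_i(τ) = 0` for `i ∈ heads` and `= -u_{i-1}(τ)` otherwise. -/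
def SolvesChain {m : ℕ} (A : ℝ → Submodule ℂ (E × E)) (σ : ℂ) (heads : Finset (Fin m))
    (u : Fin m → ℝ → E) : Prop :=
  ∀ i, SolvesAbstractODE A σ (u i) (chainRHS heads u i)

end AbstractODE

section Complexification

variable {n : ℕ}

/-- Coordinatewise real part `ℂⁿ → ℝⁿ`. -/
def vecRe (n : ℕ) : EuclideanSpace ℂ (Fin n) →L[ℝ] EuclideanSpace ℝ (Fin n) :=
  LinearMap.toContinuousLinearMap
    { toFun := fun v => WithLp.toLp 2 fun i => (v i).re
      map_add' := fun v w => by ext i; simp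
      map_smul' := fun c v => by ext i; simp }

/-- Coordinatewise imaginary part `ℂⁿ → ℝⁿ`. -/
def vecIm (n : ℕ) : EuclideanSpace ℂ (Fin n) →L[ℝ] EuclideanSpace ℝ (Fin n) :=
  LinearMap.toContinuousLinearMap
    { toFun := fun v => WithLp.toLp 2 fun i => (v i).im
      map_add' := fun v w => by ext i; simp
      map_smul' := fun c v => by ext i; simp }

/-- The inclusion `ℝⁿ → ℂⁿ`. -/
def vecOfReal (n : ℕ) : EuclideanSpace ℝ (Fin n) →L[ℝ] EuclideanSpace ℂ (Fin n) :=
  LinearMap.toContinuousLinearMap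
    { toFun := fun v => WithLp.toLp 2 fun i => (v i : ℂ)
      map_add' := fun v w => by ext i; simp
      map_smul' := fun c v => by ext i; simp }

variable {h : ℝ}

/-- The complexification `φ ↦ ℓ(Re φ) + i ℓ(Im φ)` of a real operator
`ℓ : C([-h, 0], ℝⁿ) → ℝⁿ`. -/
def complexify (ℓ : HistorySpace h (EuclideanSpace ℝ (Fin n)) →L[ℝ] EuclideanSpace ℝ (Fin n)) :
    HistorySpace h (EuclideanSpace ℂ (Fin n)) →L[ℂ] EuclideanSpace ℂ (Fin n) where
  toFun φ := vecOfReal n (ℓ ((vecRe n).compLeftContinuous ℝ _ φ)) +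
    Complex.I • vecOfReal n (ℓ ((vecIm n).compLeftContinuous ℝ _ φ))
  map_add' φ ψ := by
    simp only [map_add, smul_add]; abel
  map_smul' c φ := by
    have hre : (vecRe n).compLeftContinuous ℝ (Icc (-h) (0:ℝ)) (c • φ) =
        c.re • (vecRe n).compLeftContinuous ℝ _ φ - c.im • (vecIm n).compLeftContinuous ℝ _ φ := by
      ext θ i; simp [vecRe, vecIm]
    have him : (vecIm n).compLeftContinuous ℝ (Icc (-h) (0:ℝ)) (c • φ) =
        c.re • (vecIm n).compLeftContinuous ℝ _ φ + c.im • (vecRe n).compLeftContinuous ℝ _ φ := by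
      ext θ i; simp [vecRe, vecIm]
    rw [hre, him]
    simp only [map_add, map_sub, map_smul, RingHom.id_apply]
    ext i
    simp only [PiLp.add_apply, PiLp.sub_apply, PiLp.smul_apply, smul_eq_mul, Complex.real_smul]
    conv_rhs => rw [← Complex.re_add_im c]
    linear_combination (-(c.im : ℂ) * vecOfReal n (ℓ ((vecIm n).compLeftContinuous ℝ _ φ)) i) *
      Complex.I_mul_I
  cont := by fun_prop

theorem complexify_continuous : Continuous (complexify (n := n) (h := h)) := by
  refine (ContinuousLinearMap.restrictScalarsIsometry ℂ
    (HistorySpace h (EuclideanSpace ℂ (Fin n))) (EuclideanSpace ℂ (Fin n)) ℝ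
    ℝ).isometry.isUniformInducing.isInducing.continuous_iff.2 ?_
  have : (⇑(ContinuousLinearMap.restrictScalarsIsometry ℂ
    (HistorySpace h (EuclideanSpace ℂ (Fin n))) (EuclideanSpace ℂ (Fin n)) ℝ ℝ) ∘
      complexify (n := n) (h := h)) = fun ℓ =>
      ((vecOfReal n).comp (ℓ.comp ((vecRe n).compLeftContinuous ℝ _))) +
      ((Complex.I • ContinuousLinearMap.id ℂ (EuclideanSpace ℂ (Fin n))).restrictScalars ℝ).comp
        ((vecOfReal n).comp (ℓ.comp ((vecIm n).compLeftContinuous ℝ _))) := by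
    ext ℓ; rfl
  rw [this]
  fun_prop

end Complexification

section Cycle

variable {n : ℕ} {h : ℝ}

/-- `γ` is a periodic solution of `x'(t) = F(x_t)` with (minimal) period `T`. -/
structure IsPeriodicSolution (F : HistorySpace h (EuclideanSpace ℝ (Fin n)) →
    EuclideanSpace ℝ (Fin n)) (γ : C(ℝ, EuclideanSpace ℝ (Fin n))) (T : ℝ) : Prop where
  eqn : ∀ t, HasDerivAt γ (F (hist h γ t)) t
  periodic : Function.Periodic γ T
  minimal : IsLeast {t | 0 < t ∧ hist h γ t = hist h γ 0} T

/-- The (complexified) linearization `L(t) = DF(γ_t)`. -/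
def linearization (F : HistorySpace h (EuclideanSpace ℝ (Fin n)) → EuclideanSpace ℝ (Fin n))
    (γ : C(ℝ, EuclideanSpace ℝ (Fin n))) (t : ℝ) :
    HistorySpace h (EuclideanSpace ℂ (Fin n)) →L[ℂ] EuclideanSpace ℂ (Fin n) :=
  complexify (fderiv ℝ F (hist h γ t))

theorem linearization_continuous {F : HistorySpace h (EuclideanSpace ℝ (Fin n)) →
    EuclideanSpace ℝ (Fin n)} (hF : ContDiff ℝ 1 F) (γ : C(ℝ, EuclideanSpace ℝ (Fin n))) :
    Continuous (linearization F γ) :=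
  complexify_continuous.comp ((hF.continuous_fderiv one_ne_zero).comp (hist_continuous γ))

theorem linearization_bounded {F : HistorySpace h (EuclideanSpace ℝ (Fin n)) →
    EuclideanSpace ℝ (Fin n)} (hF : ContDiff ℝ 1 F) {γ : C(ℝ, EuclideanSpace ℝ (Fin n))} {T : ℝ}
    (hγ : IsPeriodicSolution F γ T) : ∃ M, ∀ t, ‖linearization F γ t‖ ≤ M := by
  have hper : Function.Periodic (linearization F γ) T := fun t => by
    have : hist h γ (t + T) = hist h γ t := by
      ext1 θ
      show γ (t + T + θ) = γ (t + θ)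
      rw [add_right_comm, hγ.periodic]
    simp [linearization, this]
  obtain ⟨M, hM⟩ := isCompact_Icc.exists_bound_of_continuousOn (s := Icc 0 (0 + T))
    (f := linearization F γ)
    (linearization_continuous hF γ).continuousOn
  refine ⟨M, fun t => ?_⟩
  obtain ⟨x, hx, hxt⟩ := hper.exists_mem_Ico₀ hγ.minimal.1.1 t
  rw [hxt]
  exact hM x ⟨hx.1, by simpa using hx.2.le⟩

/-- The monodromy operator `U(s + T, s)` of the linearization around the cycle. -/
def monodromy (F : HistorySpace h (EuclideanSpace ℝ (Fin n)) → EuclideanSpace ℝ (Fin n))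
    (γ : C(ℝ, EuclideanSpace ℝ (Fin n))) (T s : ℝ) :
    HistorySpace h (EuclideanSpace ℂ (Fin n)) →L[ℂ] HistorySpace h (EuclideanSpace ℂ (Fin n)) :=
  evolution (linearization F γ) (s + T) s

/-- For a periodic solution, `U(s + T, s)` really is the time-`T` solution operator. -/
theorem monodromy_spec [Fact (0 < h)] {F : HistorySpace h (EuclideanSpace ℝ (Fin n)) →
    EuclideanSpace ℝ (Fin n)} (hF : ContDiff ℝ 1 F) {γ : C(ℝ, EuclideanSpace ℝ (Fin n))} {T : ℝ}
    (hγ : IsPeriodicSolution F γ T) (s : ℝ) :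
    IsEvolutionOperator (linearization F γ) s (s + T) (monodromy F γ T s) := by
  obtain ⟨M, hM⟩ := linearization_bounded hF hγ
  exact evolution_spec (linearization_continuous hF γ) hM _ _

/-- The generalized eigenspace `E_λ(s) = ⋃_k N((λ I - U(s + T, s))^k)`. -/
def genEigenspace (F : HistorySpace h (EuclideanSpace ℝ (Fin n)) → EuclideanSpace ℝ (Fin n))
    (γ : C(ℝ, EuclideanSpace ℝ (Fin n))) (T : ℝ) (μ : ℂ) (s : ℝ) :
    Submodule ℂ (HistorySpace h (EuclideanSpace ℂ (Fin n))) :=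
  Module.End.maxGenEigenspace (monodromy F γ T s).toLinearMap μ

/-- The algebraic multiplicity `m_λ`. -/
def algMult (F : HistorySpace h (EuclideanSpace ℝ (Fin n)) → EuclideanSpace ℝ (Fin n))
    (γ : C(ℝ, EuclideanSpace ℝ (Fin n))) (T : ℝ) (μ : ℂ) (s : ℝ) : ℕ :=
  Module.finrank ℂ (genEigenspace F γ T μ s)

/-- The geometric multiplicity of `λ`. -/
def geomMult (F : HistorySpace h (EuclideanSpace ℝ (Fin n)) → EuclideanSpace ℝ (Fin n))
    (γ : C(ℝ, EuclideanSpace ℝ (Fin n))) (T : ℝ) (μ : ℂ) (s : ℝ) : ℕ :=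
  Module.finrank ℂ (Module.End.eigenspace (monodromy F γ T s).toLinearMap μ)

/-- `λ` is a Floquet multiplier: a nonzero point of the spectrum of `U(s + T, s)`. -/
def IsFloquetMultiplier
    (F : HistorySpace h (EuclideanSpace ℝ (Fin n)) → EuclideanSpace ℝ (Fin n))
    (γ : C(ℝ, EuclideanSpace ℝ (Fin n))) (T : ℝ) (μ : ℂ) (s : ℝ) : Prop :=
  μ ≠ 0 ∧ μ ∈ spectrum ℂ (monodromy F γ T s)

end Cycle

end

end DelayEq
open DelayEq

/-!
The equivalence of the two systems is the identity `A^⊙⋆ j = j A`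
(`sunEmbedding_mem_sunStarGenerator_iff`). One inclusion is formal. For the other, let `R` be the
resolvent of the generator at some `c`, as constructed by variation of constants
(`exists_resolvent`). Integration turns the shift semigroup `T₀` into a norm continuous family, so
`x ∘ R` belongs to `X^⊙` for every functional `x`, and `x ∘ R²` to the domain of `A^⊙`. Testing
`A^⊙⋆ j φ = j ψ` with these functionals gives `R² ψ = c R² φ - R φ`. Since `R` is injective,
`φ = R (c φ - ψ)`, that is, `A φ = ψ`. As `j` is bounded, it commutes with `d/dτ` on differentiable
curves, so the equations with `A` and with `A^⊙⋆` are the same.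

For the chains, the solution operators are compact after one delay time
(`isCompactOperator_evolution`), so some power of the period map is compact, and Riesz theory makes
the generalized eigenspace `W` at `μ ≠ 0` finite-dimensional
(`finiteDimensional_maxGenEigenspace_of_pow`). The period map restricts to an invertible operator
`A` of `W`. Its backward orbits extend to solutions on the whole line, which gives a linear map `Y`
from `W` to entire solutions with `Y w (t + T) = Y (A w) t` (`exists_floquet_flow`). At each time
`τ` the histories of these solutions fill the generalized eigenspace of `U(τ + T, τ)`.

As `A - μ` is nilpotent, `A = exp(T (σ + N))` with `N` nilpotent and `ker N = ker (A - μ)`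
(`exists_log_of_isNilpotent_sub`). For a Jordan basis `bᵢ` of `N` (`exists_jordan_basis`) put
`φᵢ(τ) = (Y (exp(-τ (σ + N)) bᵢ))_τ`. These are `T`-periodic by the choice of `N`. Since the
histories of an entire solution satisfy `d/dτ y_τ = A(τ) y_τ`, differentiation of the exponential
gives `(d/dτ - A(τ) + σ) φᵢ = -(Y (exp(-τ (σ + N)) N bᵢ))_τ`, which is `0` or `-φᵢ₋₁`. The number of
heads of Jordan chains is `dim ker N`, the geometric multiplicity.

Smoothness follows by bootstrapping: `γ` is of class `C^k`, hence so is `L`, and entire solutions of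
the linear equation and their histories are of class `C^(k+1)` (`IsEntireSolution.contDiff`,
`contDiff_hist`).
-/

namespace DelayEq

noncomputable section

/-! ### The sun-star generator on the embedded history space -/

section Resolvent

set_option linter.unusedSectionVars false

variable {h : ℝ} [Fact (0 < h)] {V : Type*} [NormedAddCommGroup V] [NormedSpace ℂ V]

theorem hasDerivAt_exp_mul (c x : ℝ) :
    HasDerivAt (fun x => Real.exp (c * x)) (Real.exp (c * x) * c) x := by
  have : HasDerivAt (fun x => c * x) c x := hasDerivAt_const_mul c
  exact this.exp

theorem iccExtendCM_apply (φ : HistorySpace h V) (θ : Icc (-h) (0 : ℝ)) :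
    ContinuousMap.IccExtendCM φ θ = φ θ :=
  ContinuousMap.IccExtendCM_of_mem θ.2

theorem iccExtendCM_norm_le (φ : HistorySpace h V) (x : ℝ) :
    ‖ContinuousMap.IccExtendCM φ x‖ ≤ ‖φ‖ :=
  φ.norm_coe_le_norm _

/-- `φ` is differentiable on `[-h, 0]` with derivative `ψ`. -/
def IsHistDeriv (φ ψ : HistorySpace h V) : Prop :=
  ∀ θ : Icc (-h) (0 : ℝ), HasDerivWithinAt (ContinuousMap.IccExtendCM φ) (ψ θ) (Icc (-h) 0) θ

theorem mem_generator_iff {ℓ : HistorySpace h V →L[ℂ] V} {φ ψ : HistorySpace h V} :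
    (φ, ψ) ∈ generator ℓ ↔ IsHistDeriv φ ψ ∧ ψ (zeroPt h) = ℓ φ := Iff.rfl

theorem IsHistDeriv.add {φ ψ φ' ψ' : HistorySpace h V} (h1 : IsHistDeriv φ ψ)
    (h2 : IsHistDeriv φ' ψ') : IsHistDeriv (φ + φ') (ψ + ψ') := fun θ => (h1 θ).add (h2 θ)

theorem IsHistDeriv.sub {φ ψ φ' ψ' : HistorySpace h V} (h1 : IsHistDeriv φ ψ)
    (h2 : IsHistDeriv φ' ψ') : IsHistDeriv (φ - φ') (ψ - ψ') := fun θ => (h1 θ).sub (h2 θ)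

theorem IsHistDeriv.smul {φ ψ : HistorySpace h V} (h1 : IsHistDeriv φ ψ) (c : ℂ) :
    IsHistDeriv (c • φ) (c • ψ) := fun θ => (h1 θ).const_smul c

theorem isHistDeriv_of_hasDerivAt {φ ψ : HistorySpace h V} {G : ℝ → V}
    (hG : ∀ θ : Icc (-h) (0 : ℝ), HasDerivAt G (ψ θ) θ) (hφ : ∀ θ : Icc (-h) (0 : ℝ), φ θ = G θ) :
    IsHistDeriv φ ψ := fun θ =>
  (hG θ).hasDerivWithinAt.congr_of_mem (fun x hx => by
    rw [ContinuousMap.IccExtendCM_of_mem hx, hφ]) θ.2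

theorem IsHistDeriv.unique {φ ψ ψ' : HistorySpace h V} (h1 : IsHistDeriv φ ψ)
    (h2 : IsHistDeriv φ ψ') : ψ = ψ' := by
  ext θ
  have hh : (0 : ℝ) < h := Fact.out
  exact (uniqueDiffOn_Icc (by linarith : -h < (0 : ℝ)) θ θ.2).eq_deriv _ (h1 θ) (h2 θ)

/-- A solution of `φ' = λ φ` on `[-h, 0]` with `φ(0) = 0` vanishes. -/
theorem eq_zero_of_isHistDeriv_smul {φ : HistorySpace h V} {c : ℝ}
    (h1 : IsHistDeriv φ ((c : ℂ) • φ)) (h0 : φ (zeroPt h) = 0) : φ = 0 := by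
  have hh : (0 : ℝ) < h := Fact.out
  set f : ℝ → V := fun x => Real.exp (-(c * x)) • ContinuousMap.IccExtendCM φ x with hf
  have hd : ∀ x ∈ Icc (-h) (0 : ℝ), HasDerivWithinAt f 0 (Icc (-h) 0) x := by
    intro x hx
    have e1 : HasDerivAt (fun x => Real.exp (-(c * x))) (Real.exp (-(c * x)) * (-c)) x := by
      simpa using hasDerivAt_exp_mul (-c) x
    have := e1.hasDerivWithinAt (s := Icc (-h) 0) |>.smul (h1 ⟨x, hx⟩)
    refine this.congr_deriv ?_
    rw [ContinuousMap.IccExtendCM_of_mem hx]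
    simp only [ContinuousMap.smul_apply, Complex.coe_smul]
    module
  have hc := constant_of_derivWithin_zero (f := f) (a := -h) (b := 0)
    (fun x hx => (hd x hx).differentiableWithinAt)
    (fun x hx => (hd x (Ico_subset_Icc_self hx)).derivWithin
      (uniqueDiffOn_Icc (by linarith) x (Ico_subset_Icc_self hx)))
  have hz : f 0 = 0 := by
    have : ContinuousMap.IccExtendCM φ 0 = φ (zeroPt h) := iccExtendCM_apply φ (zeroPt h)
    simp [hf, this, h0]
  ext θ
  have h3 : f θ = 0 := by
    rw [hc θ θ.2, ← hc 0 ⟨by linarith, le_rfl⟩, hz]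
  simpa [hf, iccExtendCM_apply, (Real.exp_pos _).ne'] using h3

theorem expIntegral_bound {c : ℝ} (hc : 0 ≤ c) (g : HistorySpace h V) (θ : Icc (-h) (0 : ℝ)) :
    ‖-(Real.exp (c * θ) • ∫ u in (0 : ℝ)..θ, Real.exp (-(c * u)) • ContinuousMap.IccExtendCM g u)‖
      ≤ Real.exp (c * h) * h * ‖g‖ := by
  have hh : (0 : ℝ) < h := Fact.out
  have h1 : ‖∫ u in (0 : ℝ)..θ, Real.exp (-(c * u)) • ContinuousMap.IccExtendCM g u‖ ≤
      (Real.exp (c * h) * ‖g‖) * |(θ : ℝ) - 0| := by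
    refine intervalIntegral.norm_integral_le_of_norm_le_const fun u hu => ?_
    rw [norm_smul, Real.norm_of_nonneg (Real.exp_pos _).le]
    rw [uIoc_of_ge θ.2.2] at hu
    gcongr
    · nlinarith [hu.1, θ.2.1]
    · exact iccExtendCM_norm_le g u
  rw [norm_neg, norm_smul, Real.norm_of_nonneg (Real.exp_pos _).le]
  have h2 : |(θ : ℝ) - 0| ≤ h := by
    rw [sub_zero, abs_of_nonpos θ.2.2]; linarith [θ.2.1]
  have h3 : Real.exp (c * θ) ≤ 1 := by
    rw [Real.exp_le_one_iff]; exact mul_nonpos_of_nonneg_of_nonpos hc θ.2.2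
  calc _ ≤ 1 * ((Real.exp (c * h) * ‖g‖) * h) := by gcongr; exact h1.trans (by gcongr)
    _ = _ := by ring

variable (h V) in
/-- The solution operator `g ↦ φ` of `φ' = c φ - g`, `φ(0) = 0` on `[-h, 0]`, by variation of
constants. -/
def expIntegral (c : ℝ) (hc : 0 ≤ c) : HistorySpace h V →L[ℂ] HistorySpace h V :=
  LinearMap.mkContinuous
    { toFun := fun g => ⟨fun θ => -(Real.exp (c * θ) •
        ∫ u in (0 : ℝ)..θ, Real.exp (-(c * u)) • ContinuousMap.IccExtendCM g u), by
          have h1 : Continuous fun t : ℝ =>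
              ∫ u in (0 : ℝ)..t, Real.exp (-(c * u)) • ContinuousMap.IccExtendCM g u :=
            intervalIntegral.continuous_primitive
              (fun a b => (by fun_prop : Continuous _).intervalIntegrable a b) 0
          have h2 := h1.comp (continuous_subtype_val (p := fun x => x ∈ Icc (-h) (0 : ℝ)))
          exact ((by fun_prop : Continuous fun θ : Icc (-h) (0 : ℝ) =>
            Real.exp (c * θ)).smul h2).neg⟩
      map_add' := fun f g => by
        ext θ
        have e : ∀ u, ContinuousMap.IccExtendCM (f + g) u =
          ContinuousMap.IccExtendCM f u + ContinuousMap.IccExtendCM g u := fun u => rfl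
        simp only [ContinuousMap.coe_mk, e, smul_add, ContinuousMap.add_apply]
        rw [intervalIntegral.integral_add
          ((by fun_prop : Continuous _).intervalIntegrable _ _)
          ((by fun_prop : Continuous _).intervalIntegrable _ _), smul_add, neg_add]
      map_smul' := fun a g => by
        ext θ
        have e : ∀ u, ContinuousMap.IccExtendCM (a • g) u =
          a • ContinuousMap.IccExtendCM g u := fun u => rfl
        simp only [ContinuousMap.coe_mk, e, ContinuousMap.smul_apply, RingHom.id_apply,
          smul_comm _ a]
        rw [intervalIntegral.integral_smul, smul_comm _ a, smul_neg] }
    (Real.exp (c * h) * h) (fun g => by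
      have hh : (0 : ℝ) < h := Fact.out
      rw [ContinuousMap.norm_le _ (by positivity)]
      exact expIntegral_bound hc g)

theorem expIntegral_apply {c : ℝ} (hc : 0 ≤ c) (g : HistorySpace h V) (θ : Icc (-h) (0 : ℝ)) :
    expIntegral h V c hc g θ = -(Real.exp (c * θ) •
        ∫ u in (0 : ℝ)..θ, Real.exp (-(c * u)) • ContinuousMap.IccExtendCM g u) := rfl

theorem expIntegral_zeroPt {c : ℝ} (hc : 0 ≤ c) (g : HistorySpace h V) :
    expIntegral h V c hc g (zeroPt h) = 0 := by
  rw [expIntegral_apply]; simp [zeroPt]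

theorem isHistDeriv_expIntegral [CompleteSpace V] {c : ℝ} (hc : 0 ≤ c) (g : HistorySpace h V) :
    IsHistDeriv (expIntegral h V c hc g) ((c : ℂ) • expIntegral h V c hc g - g) := by
  refine isHistDeriv_of_hasDerivAt (G := fun x => -(Real.exp (c * x) •
    ∫ u in (0 : ℝ)..x, Real.exp (-(c * u)) • ContinuousMap.IccExtendCM g u)) (fun θ => ?_)
    (expIntegral_apply hc g)
  have hcont : Continuous fun u => Real.exp (-(c * u)) • ContinuousMap.IccExtendCM g u := by
    fun_prop
  have h1 := intervalIntegral.integral_hasDerivAt_right (hcont.intervalIntegrable 0 (θ : ℝ))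
    (hcont.stronglyMeasurableAtFilter _ _) hcont.continuousAt
  refine ((hasDerivAt_exp_mul c θ).smul h1).neg.congr_deriv ?_
  rw [iccExtendCM_apply, smul_smul, ← Real.exp_add, add_neg_cancel, Real.exp_zero]
  simp only [ContinuousMap.sub_apply, ContinuousMap.smul_apply, Complex.coe_smul,
    expIntegral_apply]
  module

/-- The factorization of `expIntegral c` through the unweighted integral, by which norm continuity
of `t ↦ J ∘ T₀(t)` need only be checked for the integration operator `J = expIntegral 0`. -/
theorem expIntegral_factor [CompleteSpace V] {c : ℝ} (hc : 0 ≤ c) (g : HistorySpace h V) :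
    expIntegral h V c hc g = expIntegral h V 0 le_rfl g -
      (c : ℂ) • expIntegral h V c hc (expIntegral h V 0 le_rfl g) := by
  rw [← sub_eq_zero]
  refine eq_zero_of_isHistDeriv_smul (c := c) ?_ (by simp [expIntegral_zeroPt])
  have h0 := isHistDeriv_expIntegral le_rfl g
  have hc1 := isHistDeriv_expIntegral hc g
  have hc2 := isHistDeriv_expIntegral hc (expIntegral h V 0 le_rfl g)
  convert hc1.sub (h0.sub (hc2.smul (c : ℂ))) using 1
  simp only [Complex.ofReal_zero]
  module

variable (h V) in
/-- The exponential histories `θ ↦ exp(c θ) v`. -/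
def expHistory (c : ℝ) (hc : 0 ≤ c) : V →L[ℂ] HistorySpace h V :=
  LinearMap.mkContinuous
    { toFun := fun v => ⟨fun θ => Real.exp (c * θ) • v, by fun_prop⟩
      map_add' := fun v w => by ext; simp
      map_smul' := fun a v => by ext; simp [smul_comm _ a] }
    1 (fun v => by
      rw [ContinuousMap.norm_le _ (by positivity)]
      intro θ
      have h3 : Real.exp (c * θ) ≤ 1 := by
        rw [Real.exp_le_one_iff]; exact mul_nonpos_of_nonneg_of_nonpos hc θ.2.2
      show ‖Real.exp (c * θ) • v‖ ≤ _
      rw [norm_smul, Real.norm_of_nonneg (Real.exp_pos _).le]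
      gcongr)

theorem expHistory_apply {c : ℝ} (hc : 0 ≤ c) (v : V) (θ : Icc (-h) (0 : ℝ)) :
    expHistory h V c hc v θ = Real.exp (c * θ) • v := rfl

theorem expHistory_norm_le {c : ℝ} (hc : 0 ≤ c) : ‖expHistory h V c hc‖ ≤ 1 :=
  LinearMap.mkContinuous_norm_le _ zero_le_one _

theorem expHistory_zeroPt {c : ℝ} (hc : 0 ≤ c) (v : V) :
    expHistory h V c hc v (zeroPt h) = v := by
  rw [expHistory_apply]; simp [zeroPt]

theorem isHistDeriv_expHistory {c : ℝ} (hc : 0 ≤ c) (v : V) :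
    IsHistDeriv (expHistory h V c hc v) ((c : ℂ) • expHistory h V c hc v) := by
  refine isHistDeriv_of_hasDerivAt (G := fun x => Real.exp (c * x) • v) (fun θ => ?_)
    (expHistory_apply hc v)
  refine ((hasDerivAt_exp_mul c θ).smul_const v).congr_deriv ?_
  simp only [ContinuousMap.smul_apply, Complex.coe_smul, expHistory_apply]
  module

theorem shiftSemigroup_apply_zeroPt {t : ℝ} (ht : 0 ≤ t) (g : HistorySpace h V) :
    shiftSemigroup h V t g (zeroPt h) = g (zeroPt h) := by
  have hh : (0 : ℝ) < h := Fact.out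
  show g _ = g _
  congr 1
  ext
  simp [zeroPt, ht, hh.le]

theorem iccExtendCM_shiftSemigroup (t : ℝ) (g : HistorySpace h V) {x : ℝ}
    (hx : x ∈ Icc (-h) (0 : ℝ)) :
    ContinuousMap.IccExtendCM (shiftSemigroup h V t g) x = ContinuousMap.IccExtendCM g (x + t) := by
  rw [ContinuousMap.IccExtendCM_of_mem hx]
  show g _ = g (projIcc (-h) 0 Fact.out _)
  congr 1
  ext
  simp only [ContinuousMap.coe_mk, projIcc, add_comm t x]
  rw [min_comm]

/-- Integration regularizes: `t ↦ J ∘ T₀(t)` is Lipschitz in the operator norm for the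
integration operator `J`. -/
theorem continuousOn_expIntegral_comp_shiftSemigroup :
    ContinuousOn (fun t => (expIntegral h V 0 le_rfl).comp (shiftSemigroup h V t))
      (Ici (0 : ℝ)) := by
  suffices LipschitzOnWith 2 (fun t => (expIntegral h V 0 le_rfl).comp (shiftSemigroup h V t))
      (Ici (0 : ℝ)) from this.continuousOn
  refine LipschitzOnWith.of_dist_le_mul ?_
  intro t ht t' ht'
  rw [dist_eq_norm, Real.dist_eq]
  refine ContinuousLinearMap.opNorm_le_bound _ (by positivity) fun g => ?_
  rw [ContinuousMap.norm_le _ (by positivity)]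
  intro θ
  have e : ∀ r : ℝ, 0 ≤ r → expIntegral h V 0 le_rfl (shiftSemigroup h V r g) θ =
      -∫ u in r..(θ + r), ContinuousMap.IccExtendCM g u := by
    intro r hr
    rw [expIntegral_apply]
    simp only [zero_mul, Real.exp_zero, neg_zero, one_smul]
    rw [intervalIntegral.integral_congr (g := fun u => ContinuousMap.IccExtendCM g (u + r)),
      intervalIntegral.integral_comp_add_right, zero_add]
    intro u hu
    rw [uIcc_of_ge θ.2.2] at hu
    exact iccExtendCM_shiftSemigroup r g ⟨θ.2.1.trans hu.1, hu.2⟩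
  show ‖expIntegral h V 0 le_rfl (shiftSemigroup h V t g) θ -
    expIntegral h V 0 le_rfl (shiftSemigroup h V t' g) θ‖ ≤ _
  have hi : ∀ a b, IntervalIntegrable (ContinuousMap.IccExtendCM g) MeasureTheory.volume a b :=
    fun a b => (by fun_prop : Continuous _).intervalIntegrable a b
  rw [e t ht, e t' ht', neg_sub_neg,
    intervalIntegral.integral_interval_sub_interval_comm (hi _ _) (hi _ _) (hi _ _)]
  have b : ∀ a b : ℝ, ‖∫ u in a..b, ContinuousMap.IccExtendCM g u‖ ≤ ‖g‖ * |b - a| := fun a b =>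
    intervalIntegral.norm_integral_le_of_norm_le_const fun u _ => iccExtendCM_norm_le g u
  refine (norm_sub_le _ _).trans ((add_le_add (b _ _) (b _ _)).trans ?_)
  rw [add_sub_add_left_eq_sub]
  simp only [NNReal.coe_ofNat]
  linarith [mul_comm ‖g‖ |t - t'|]

/-- The generator has a bounded resolvent `R` at some `c`, and `t ↦ R ∘ T₀(t)` is continuous in the
operator norm. Solving `c φ - φ' = g` by variation of constants gives `φ = E v + I g`, where
`E v = exp(c ·) v` and `I g` vanishes at `0`; the condition `φ'(0) = ℓ φ` becomes
`(c - ℓ E) v = g(0) + ℓ I g`. -/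
theorem exists_resolvent [CompleteSpace V] (ℓ : HistorySpace h V →L[ℂ] V) :
    ∃ (c : ℂ) (R : HistorySpace h V →L[ℂ] HistorySpace h V),
      (∀ g, (R g, c • R g - g) ∈ generator ℓ) ∧
      (∀ φ ψ, (φ, ψ) ∈ generator ℓ → R (c • φ - ψ) = φ) ∧
      ContinuousOn (fun t => R.comp (shiftSemigroup h V t)) (Ici (0 : ℝ)) := by
  -- `‖E‖ ≤ 1`, so `c - ℓ ∘ E` is invertible by a Neumann series for `c > ‖ℓ‖`
  set c : ℝ := ‖ℓ‖ + 1 with hcdef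
  have hc : 0 ≤ c := by positivity
  have hcpos : 0 < c := by positivity
  set E := expHistory h V c hc
  set I := expIntegral h V c hc
  have hnorm : ‖((c : ℂ)⁻¹ • ℓ.comp E : V →L[ℂ] V)‖ < 1 := by
    rw [norm_smul, norm_inv, Complex.norm_real, Real.norm_of_nonneg hc]
    have : ‖ℓ.comp E‖ ≤ ‖ℓ‖ * 1 :=
      (ℓ.opNorm_comp_le E).trans (by gcongr; exact expHistory_norm_le hc)
    rw [inv_mul_lt_iff₀ hcpos]
    linarith
  set u := Units.oneSub _ hnorm with hu
  -- `Q` inverts `c - ℓ ∘ E`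
  set Q : V →L[ℂ] V := (c : ℂ)⁻¹ • (↑u⁻¹ : V →L[ℂ] V) with hQ
  have hcc : (c : ℂ) ≠ 0 := by exact_mod_cast hcpos.ne'
  have hQ1 : ∀ v, (c : ℂ) • Q v - ℓ (E (Q v)) = v := by
    intro v
    have h1 : ((u : V →L[ℂ] V) * (↑u⁻¹ : V →L[ℂ] V)) v = v := by simp
    rw [hu, Units.val_oneSub] at h1
    have h2 : (↑u⁻¹ : V →L[ℂ] V) v - (c : ℂ)⁻¹ • ℓ (E ((↑u⁻¹ : V →L[ℂ] V) v)) = v := h1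
    rw [hQ, smul_apply, smul_inv_smul₀ hcc, map_smul, map_smul]
    exact h2
  have hQ2 : ∀ v, Q ((c : ℂ) • v - ℓ (E v)) = v := by
    intro v
    have h1 : ((↑u⁻¹ : V →L[ℂ] V) * (u : V →L[ℂ] V)) v = v := by simp
    have h2 : (↑u⁻¹ : V →L[ℂ] V) (v - (c : ℂ)⁻¹ • ℓ (E v)) = v := by
      rw [hu, Units.val_oneSub] at h1; exact h1
    rw [hQ, smul_apply, ← map_smul, smul_sub, inv_smul_smul₀ hcc]
    exact h2
  set ev : HistorySpace h V →L[ℂ] V := ContinuousMap.evalCLM ℂ (zeroPt h)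
  set R : HistorySpace h V →L[ℂ] HistorySpace h V :=
    (E.comp Q).comp (ev + ℓ.comp I) + I with hR
  have hRg : ∀ g, R g = E (Q (g (zeroPt h) + ℓ (I g))) + I g := fun g => rfl
  have hR1 : ∀ g, (R g, (c : ℂ) • R g - g) ∈ generator ℓ := by
    intro g
    rw [mem_generator_iff]
    constructor
    · rw [hRg]
      convert (isHistDeriv_expHistory hc (Q (g (zeroPt h) + ℓ (I g)))).add
        (isHistDeriv_expIntegral hc g) using 1
      rw [smul_add]; abel
    · have h1 := hQ1 (g (zeroPt h) + ℓ (I g))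
      rw [hRg, ContinuousMap.sub_apply, ContinuousMap.smul_apply, ContinuousMap.add_apply,
        expHistory_zeroPt, expIntegral_zeroPt, add_zero, map_add ℓ]
      rw [sub_eq_iff_eq_add] at h1 ⊢
      rw [h1]; abel
  refine ⟨c, R, hR1, fun φ ψ hφ => ?_, ?_⟩
  -- `χ` is an eigenvector of the generator at `c`, hence a multiple of the exponential history
  · have h1 := hR1 ((c : ℂ) • φ - ψ)
    have h2 := sub_mem h1 hφ
    set χ := R ((c : ℂ) • φ - ψ) - φ with hχ
    have h3 : IsHistDeriv χ ((c : ℂ) • χ) ∧ ((c : ℂ) • χ) (zeroPt h) = ℓ χ := by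
      have e : (R ((c : ℂ) • φ - ψ), (c : ℂ) • R ((c : ℂ) • φ - ψ) - ((c : ℂ) • φ - ψ)) - (φ, ψ)
          = (χ, (c : ℂ) • χ) := by
        ext1
        · rfl
        · simp only [hχ, Prod.snd_sub, smul_sub]; abel
      rw [e] at h2
      exact mem_generator_iff.1 h2
    have h4 : χ - E (χ (zeroPt h)) = 0 := by
      refine eq_zero_of_isHistDeriv_smul (c := c) ?_ (by simp [E, expHistory_zeroPt])
      rw [smul_sub]
      exact h3.1.sub (isHistDeriv_expHistory hc _)
    have h5 : χ (zeroPt h) = 0 := by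
      rw [← hQ2 (χ (zeroPt h)), ← sub_eq_zero.1 h4, ← h3.2]
      simp
    rw [h5, map_zero, sub_zero] at h4
    exact sub_eq_zero.1 h4
  · have hI : ContinuousOn (fun t => I.comp (shiftSemigroup h V t)) (Ici (0 : ℝ)) := by
      have e : ∀ t, I.comp (shiftSemigroup h V t) =
          (ContinuousLinearMap.id ℂ _ - (c : ℂ) • I).comp
            ((expIntegral h V 0 le_rfl).comp (shiftSemigroup h V t)) := by
        intro t
        ext1 g
        exact expIntegral_factor hc _
      simp only [e]
      exact continuousOn_const.clm_comp continuousOn_expIntegral_comp_shiftSemigroup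
    -- the point evaluation at `0` causes no discontinuity, as `T₀(t)` does not change it
    have e : ∀ t ∈ Ici (0 : ℝ), R.comp (shiftSemigroup h V t) =
        (E.comp Q).comp ev + (E.comp (Q.comp ℓ) + ContinuousLinearMap.id ℂ _).comp
          (I.comp (shiftSemigroup h V t)) := by
      intro t ht
      ext1 g
      show E (Q (shiftSemigroup h V t g (zeroPt h) + ℓ (I (shiftSemigroup h V t g)))) +
        I (shiftSemigroup h V t g) = E (Q (g (zeroPt h))) +
          (E (Q (ℓ (I (shiftSemigroup h V t g)))) + I (shiftSemigroup h V t g))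
      rw [shiftSemigroup_apply_zeroPt ht, map_add, map_add, add_assoc]
    exact (continuousOn_const.add (continuousOn_const.clm_comp hI)).congr e

/-- `A^⊙⋆ j = j A`: the sun-star generator restricts on `X` to the generator. With `R` the resolvent
at `c`, the functionals `x ∘ R²` lie in the domain of `A^⊙`, with `A^⊙ (x ∘ R²) = c x ∘ R² - x ∘ R`,
and there are enough of them to separate the points of `X`. -/
theorem sunEmbedding_mem_sunStarGenerator_iff [CompleteSpace V] (ℓ : HistorySpace h V →L[ℂ] V)
    (φ ψ : HistorySpace h V) :
    (sunEmbedding (shiftSemigroup h V) φ, sunEmbedding (shiftSemigroup h V) ψ) ∈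
      sunStarGenerator ℓ ↔ (φ, ψ) ∈ generator ℓ := by
  constructor
  · intro H
    obtain ⟨c, R, hR1, hR2, hR3⟩ := exists_resolvent ℓ
    have hsun : ∀ x : StrongDual ℂ (HistorySpace h V),
        x.comp R ∈ sunSubmodule (shiftSemigroup h V) := fun x =>
      (continuousOn_const (c := x)).clm_comp hR3
    have key : R (R ψ) = c • R (R φ) - R φ := by
      rw [SeparatingDual.eq_iff_forall_dual_eq (R := ℂ)]
      intro x
      let a : SunDual (shiftSemigroup h V) := ⟨(x.comp R).comp R, hsun _⟩
      let b : SunDual (shiftSemigroup h V) := ⟨x.comp R, hsun x⟩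
      have hab : (a, c • a - b) ∈ sunGenerator ℓ := by
        show ∀ q ∈ generator ℓ, c * x (R (R q.1)) - x (R q.1) = x (R (R q.2))
        intro q hq
        have := congrArg (fun z => x (R z)) (hR2 q.1 q.2 hq)
        simp only [map_sub, map_smul, smul_eq_mul] at this
        rw [← this]; ring
      have h1 : x (R (R ψ)) = c * x (R (R φ)) - x (R φ) := H _ hab
      rw [h1]; simp
    have hinj : ∀ g, R g = 0 → g = 0 := by
      intro g hg
      have h1 := (mem_generator_iff.1 (hR1 g)).1
      rw [hg] at h1
      have h2 : IsHistDeriv (0 : HistorySpace h V) 0 := (generator ℓ).zero_mem.1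
      simpa using h1.unique h2
    have h1 : R (c • φ - ψ) = φ := by
      rw [← sub_eq_zero]
      refine hinj _ ?_
      rw [map_sub, map_sub, map_sub, map_smul, map_smul, key]; abel
    have h2 := hR1 (c • φ - ψ)
    rw [h1] at h2
    simpa using h2
  · intro H q hq
    exact (hq _ H).symm

/-- For differentiable `u`, the abstract equations with `A` and with `A^⊙⋆` are equivalent. -/
theorem solvesAbstractODE_sunStar_iff [CompleteSpace V] (ℓ : ℝ → HistorySpace h V →L[ℂ] V)
    (σ : ℂ) {u g : ℝ → HistorySpace h V} (hu : Differentiable ℝ u) :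
    SolvesAbstractODE (fun τ => sunStarGenerator (ℓ τ)) σ
      (fun τ => sunEmbedding (shiftSemigroup h V) (u τ))
      (fun τ => sunEmbedding (shiftSemigroup h V) (g τ)) ↔
    SolvesAbstractODE (fun τ => generator (ℓ τ)) σ u g := by
  have hd : ∀ τ, HasDerivAt (fun τ => sunEmbedding (shiftSemigroup h V) (u τ))
      (sunEmbedding (shiftSemigroup h V) (deriv u τ)) τ := fun τ =>
    ((sunEmbedding (shiftSemigroup h V)).restrictScalars ℝ).hasFDerivAt.comp_hasDerivAt τ
      (hu τ).hasDerivAt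
  constructor
  · intro H τ
    obtain ⟨u', Au, h1, h2, h3⟩ := H τ
    rw [h1.unique (hd τ)] at h3
    refine ⟨deriv u τ, deriv u τ + σ • u τ - g τ, (hu τ).hasDerivAt, ?_, by abel⟩
    rw [← sunEmbedding_mem_sunStarGenerator_iff]
    convert h2 using 2
    rw [map_sub, map_add, map_smul, sub_eq_iff_eq_add, ← sub_eq_iff_eq_add',
      add_sub_right_comm]
    exact h3
  · intro H τ
    obtain ⟨u', Au, h1, h2, h3⟩ := H τ
    refine ⟨_, _, hd τ, (sunEmbedding_mem_sunStarGenerator_iff _ _ _).2 h2, ?_⟩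
    show _ = sunEmbedding (shiftSemigroup h V) (g τ)
    rw [← h3, map_add, map_sub, map_smul, h1.deriv]

/-- The chain equations in `X^⊙⋆` and in `X` are equivalent. -/
theorem solvesChain_sunStar_iff [CompleteSpace V] {m : ℕ} (ℓ : ℝ → HistorySpace h V →L[ℂ] V)
    (σ : ℂ) (heads : Finset (Fin m)) {u : Fin m → ℝ → HistorySpace h V}
    (hu : ∀ i, Differentiable ℝ (u i)) :
    SolvesChain (fun τ => sunStarGenerator (ℓ τ)) σ heads
      (fun i τ => sunEmbedding (shiftSemigroup h V) (u i τ)) ↔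
    SolvesChain (fun τ => generator (ℓ τ)) σ heads u := by
  refine forall_congr' fun i => ?_
  rw [← solvesAbstractODE_sunStar_iff ℓ σ (hu i)]
  have : chainRHS heads (fun i τ => sunEmbedding (shiftSemigroup h V) (u i τ)) i =
      fun τ => sunEmbedding (shiftSemigroup h V) (chainRHS heads u i τ) := by
    ext1 τ
    unfold chainRHS
    split_ifs <;> simp
  rw [this]

end Resolvent

/-! ### Riesz theory of generalized eigenspaces -/

section Riesz

variable {X : Type*} [NormedAddCommGroup X] [NormedSpace ℂ X]

theorem isClosed_genEigenspace (K : X →L[ℂ] X) (ν : ℂ) (k : ℕ) :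
    IsClosed (Module.End.genEigenspace (K : Module.End ℂ X) ν k : Set X) := by
  have e : (Module.End.genEigenspace (K : Module.End ℂ X) ν k : Set X) =
      {x | ((K - ν • 1) ^ k : X →L[ℂ] X) x = 0} := by
    ext x
    rw [SetLike.mem_coe, Module.End.mem_genEigenspace_nat, LinearMap.mem_ker, mem_ofPred_eq,
      ← ContinuousLinearMap.coe_coe, ContinuousLinearMap.toLinearMap_pow]
    rfl
  rw [e]
  exact isClosed_eq (ContinuousLinearMap.continuous _) continuous_const

theorem mem_genEigenspace_succ (f : Module.End ℂ X) (ν : ℂ) (k : ℕ) (x : X) :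
    x ∈ f.genEigenspace ν (k + 1 : ℕ) ↔ f x - ν • x ∈ f.genEigenspace ν k := by
  rw [Module.End.mem_genEigenspace_nat, Module.End.mem_genEigenspace_nat, LinearMap.mem_ker,
    LinearMap.mem_ker, pow_succ, Module.End.mul_apply]
  rfl

/-- The ascending chain `ker (K - ν)^k` stabilizes: otherwise Riesz' lemma gives vectors `f k` in
`ker (K - ν)^(k+1)` whose images under `K` stay at distance `‖ν‖` from each other. -/
theorem exists_genEigenspace_succ_le {K : X →L[ℂ] X} (hK : IsCompactOperator K) {ν : ℂ}
    (hν : ν ≠ 0) : ∃ k : ℕ, Module.End.genEigenspace (K : Module.End ℂ X) ν (k + 1 : ℕ) ≤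
      Module.End.genEigenspace (K : Module.End ℂ X) ν k := by
  set G : ℕ → Submodule ℂ X := fun k => Module.End.genEigenspace (K : Module.End ℂ X) ν k with hG
  have hmono : Monotone G := fun a b hab =>
    (Module.End.genEigenspace (K : Module.End ℂ X) ν).monotone (by exact_mod_cast hab)
  have hsucc : ∀ k x, x ∈ G (k + 1) ↔ K x - ν • x ∈ G k := fun k x =>
    mem_genEigenspace_succ (K : Module.End ℂ X) ν k x
  by_contra! hcon
  have hx : ∀ k, ∃ x ∈ G (k + 1), ‖x‖ ≤ 3 ∧ ∀ y ∈ G k, 1 ≤ ‖x - y‖ := by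
    intro k
    obtain ⟨x, hx1, hx2⟩ := SetLike.not_le_iff_exists.1 (hcon k)
    obtain ⟨⟨z, hz⟩, hz1, hz2⟩ := riesz_lemma_of_norm_lt (𝕜 := ℂ) (c := 2) (R := 3) (by simp)
      (by norm_num) (F := (G k).comap (G (k + 1)).subtype)
      ((isClosed_genEigenspace K ν k).preimage continuous_subtype_val) ⟨⟨x, hx1⟩, hx2⟩
    exact ⟨z, hz, hz1, fun y hy => hz2 ⟨y, hmono k.le_succ hy⟩ hy⟩
  choose f hf1 hf2 hf3 using hx
  have hsep : ∀ m n, m < n → ‖ν‖ ≤ ‖K (f n) - K (f m)‖ := by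
    intro m n hmn
    have h1 : K (f n) - ν • f n ∈ G n := (hsucc n _).1 (hf1 n)
    have h2 : f m ∈ G n := hmono hmn (hf1 m)
    have h3 : K (f m) ∈ G n := by
      have := hmono (Nat.le_succ m |>.trans hmn) ((hsucc m _).1 (hf1 m))
      have := add_mem this ((G n).smul_mem ν h2)
      rwa [sub_add_cancel] at this
    have h4 : ν⁻¹ • (K (f m) - (K (f n) - ν • f n)) ∈ G n := (G n).smul_mem _ (sub_mem h3 h1)
    have h5 : K (f n) - K (f m) = ν • (f n - ν⁻¹ • (K (f m) - (K (f n) - ν • f n))) := by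
      rw [smul_sub, smul_inv_smul₀ hν]; abel
    rw [h5, norm_smul]
    exact le_mul_of_one_le_right (norm_nonneg _) (hf3 n _ h4)
  obtain ⟨C, hC, hC'⟩ := hK.image_closedBall_subset_compact (f := (K : X →ₗ[ℂ] X)) 3
  obtain ⟨y, -, ψ, hψ, hψy⟩ := hC.tendsto_subseq
    (fun n => hC' ⟨f n, by simpa using hf2 n, rfl⟩)
  obtain ⟨N, hN⟩ := Metric.cauchySeq_iff'.1 hψy.cauchySeq ‖ν‖ (by positivity)
  have h1 := hN (N + 1) (Nat.le_succ N)
  rw [dist_eq_norm] at h1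
  exact h1.not_ge (hsep _ _ (hψ N.lt_succ_self))

/-- On the eigenspace `K = ν`, so that the identity is compact there; the higher kernels follow by
rank–nullity for `K - ν`. -/
theorem finiteDimensional_genEigenspace {K : X →L[ℂ] X} (hK : IsCompactOperator K) {ν : ℂ}
    (hν : ν ≠ 0) (k : ℕ) :
    FiniteDimensional ℂ (Module.End.genEigenspace (K : Module.End ℂ X) ν k) := by
  set G : ℕ → Submodule ℂ X := fun k => Module.End.genEigenspace (K : Module.End ℂ X) ν k with hG
  have hsucc : ∀ k x, x ∈ G (k + 1) ↔ K x - ν • x ∈ G k := fun k x =>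
    mem_genEigenspace_succ (K : Module.End ℂ X) ν k x
  have hG0 : G 0 = ⊥ := by simp [hG]
  have h1 : FiniteDimensional ℂ (G 1) := by
    have hmem : ∀ x ∈ G 1, K x = ν • x := fun x hx => by
      have := (hsucc 0 x).1 hx
      rw [hG0, Submodule.mem_bot, sub_eq_zero] at this
      exact this
    refine FiniteDimensional.of_isCompactOperator_id (𝕜 := ℂ) ?_
    have hinv : ∀ x ∈ G 1, (K : X →ₗ[ℂ] X) x ∈ G 1 := fun x hx => by
      show K x ∈ G 1
      rw [hmem x hx]; exact (G 1).smul_mem _ hx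
    have h2 := hK.restrict (f := (K : X →ₗ[ℂ] X)) (V := G 1) hinv (isClosed_genEigenspace K ν 1)
    have h3 := h2.smul ν⁻¹
    have e : (id : G 1 → G 1) = ν⁻¹ • (LinearMap.restrict (K : X →ₗ[ℂ] X) hinv : G 1 → G 1) := by
      funext x
      refine Subtype.ext ?_
      show (x : X) = ν⁻¹ • K x
      rw [hmem x x.2, inv_smul_smul₀ hν]
    rw [e]
    exact h3
  show FiniteDimensional ℂ (G k)
  induction k with
  | zero => rw [hG0]; infer_instance
  | succ k ih =>
    rw [← Submodule.fg_iff_finiteDimensional] at ih h1 ⊢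
    refine Submodule.fg_of_fg_map_of_fg_inf_ker ((K : X →ₗ[ℂ] X) - ν • LinearMap.id) ?_ ?_
    · have : FiniteDimensional ℂ (G k) := (Submodule.fg_iff_finiteDimensional _).1 ih
      refine (Submodule.fg_iff_finiteDimensional _).2
        (Submodule.finiteDimensional_of_le (S₂ := G k) ?_)
      rintro _ ⟨x, hx, rfl⟩
      exact (hsucc k x).1 hx
    · have : FiniteDimensional ℂ (G 1) := (Submodule.fg_iff_finiteDimensional _).1 h1
      refine (Submodule.fg_iff_finiteDimensional _).2
        (Submodule.finiteDimensional_of_le (S₂ := G 1) ?_)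
      rintro x ⟨-, hx⟩
      rw [hsucc, hG0]
      exact hx

/-- Riesz theory: the generalized eigenspaces of a compact operator at `ν ≠ 0` are
finite-dimensional. -/
theorem finiteDimensional_maxGenEigenspace {K : X →L[ℂ] X} (hK : IsCompactOperator K) {ν : ℂ}
    (hν : ν ≠ 0) : FiniteDimensional ℂ (Module.End.maxGenEigenspace (K : Module.End ℂ X) ν) := by
  obtain ⟨k, hk⟩ := exists_genEigenspace_succ_le hK hν
  have hall : ∀ l, Module.End.genEigenspace (K : Module.End ℂ X) ν (k + l : ℕ) ≤
      Module.End.genEigenspace (K : Module.End ℂ X) ν k := by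
    intro l
    induction l with
    | zero => exact le_rfl
    | succ l ih =>
      intro x hx
      rw [← add_assoc, mem_genEigenspace_succ] at hx
      exact hk ((mem_genEigenspace_succ _ _ _ _).2 (ih hx))
  have := finiteDimensional_genEigenspace hK hν k
  refine Submodule.finiteDimensional_of_le
    (S₂ := Module.End.genEigenspace (K : Module.End ℂ X) ν k) fun x hx => ?_
  obtain ⟨l, hl⟩ := (Module.End.mem_maxGenEigenspace _ _ _).1 hx
  refine hall l ((Module.End.genEigenspace (K : Module.End ℂ X) ν).monotone
    (show (l : ℕ∞) ≤ (k + l : ℕ) by exact_mod_cast Nat.le_add_left l k) ?_)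
  rw [Module.End.mem_genEigenspace_nat]
  exact hl

theorem maxGenEigenspace_le_pow (U : Module.End ℂ X) (μ : ℂ) (N : ℕ) :
    U.maxGenEigenspace μ ≤ (U ^ N).maxGenEigenspace (μ ^ N) := by
  intro x hx
  obtain ⟨l, hl⟩ := (Module.End.mem_maxGenEigenspace _ _ _).1 hx
  refine (Module.End.mem_maxGenEigenspace _ _ _).2 ⟨l, ?_⟩
  obtain ⟨c, hc⟩ := sub_dvd_pow_sub_pow (Polynomial.X : Polynomial ℂ) (Polynomial.C μ) N
  have h1 := congrArg (fun p => Polynomial.aeval U (p ^ l)) ((mul_comm _ _).trans hc.symm)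
  simp only [mul_pow, map_mul, map_pow, map_sub, Polynomial.aeval_X, Polynomial.aeval_C,
    Algebra.algebraMap_eq_smul_one] at h1
  rw [smul_pow, one_pow] at h1
  rw [← h1, Module.End.mul_apply, hl, map_zero]

/-- The generalized eigenspaces at `μ ≠ 0` of an operator with a compact power are
finite-dimensional. -/
theorem finiteDimensional_maxGenEigenspace_of_pow {U : X →L[ℂ] X} {N : ℕ}
    (hU : IsCompactOperator (U ^ N : X →L[ℂ] X)) {μ : ℂ} (hμ : μ ≠ 0) :
    FiniteDimensional ℂ (Module.End.maxGenEigenspace (U : Module.End ℂ X) μ) := by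
  have := finiteDimensional_maxGenEigenspace hU (pow_ne_zero N hμ)
  refine Submodule.finiteDimensional_of_le
    (S₂ := Module.End.maxGenEigenspace ((U ^ N : X →L[ℂ] X) : Module.End ℂ X) (μ ^ N)) ?_
  rw [ContinuousLinearMap.toLinearMap_pow]
  exact maxGenEigenspace_le_pow _ _ _

end Riesz

/-! ### Logarithms of unipotent elements -/

section NilpotentLog

/-- `exp z = 1 + z + z² w` for nilpotent `z`. -/
theorem exists_exp_eq_one_add {A : Type*} [CommRing A] [Algebra ℚ A] {z : A} (hz : IsNilpotent z) :
    ∃ w, IsNilpotent.exp z = 1 + z + z ^ 2 * w := by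
  obtain ⟨k, hk⟩ := hz
  have hk2 : z ^ (k + 2) = 0 := by rw [pow_add, hk, zero_mul]
  refine ⟨∑ i ∈ Finset.range k, ((i + 2).factorial : ℚ)⁻¹ • z ^ i, ?_⟩
  rw [IsNilpotent.exp_eq_sum hk2, Finset.sum_range_succ', Finset.sum_range_succ', Finset.mul_sum]
  simp only [mul_smul_comm, ← pow_add]
  simp [add_comm, add_left_comm, add_assoc]

/-- Newton iteration for the logarithm: `exp a = 1 + x` is solvable modulo every power of `x`. -/
theorem exists_exp_approx {A : Type*} [CommRing A] [Algebra ℚ A] {x : A} (hx : IsNilpotent x)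
    (k : ℕ) : ∃ a, x ∣ a ∧ x ^ (k + 1) ∣ IsNilpotent.exp a - (1 + x) := by
  have hnil : ∀ a, x ∣ a → IsNilpotent a := fun a ⟨c, hc⟩ =>
    hc ▸ (Commute.all x c).isNilpotent_mul_right hx
  induction k with
  | zero => exact ⟨0, dvd_zero _, ⟨-1, by rw [IsNilpotent.exp_zero]; ring⟩⟩
  | succ k ih =>
    obtain ⟨a, ha, c, hc⟩ := ih
    -- a Newton step: `exp z = 1 + z + O(z²)` cancels the error `x ^ (k + 1) * c` to first order
    set z := -(x ^ (k + 1) * c) with hz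
    have hxz : x ∣ z := by rw [hz, pow_succ']; exact ⟨-(x ^ k * c), by ring⟩
    obtain ⟨w, hw⟩ := exists_exp_eq_one_add (hnil z hxz)
    refine ⟨a + z, dvd_add ha hxz,
      -c + x ^ k * c * (-c) + x ^ k * c ^ 2 * w * (IsNilpotent.exp a), ?_⟩
    rw [IsNilpotent.exp_add_of_commute (Commute.all _ _) (hnil a ha) (hnil z hxz), hw]
    rw [sub_eq_iff_eq_add] at hc
    rw [hc, hz]
    ring

/-- The logarithm of a unipotent element `1 + x`; it generates the same ideal as `x`. -/
theorem exists_nilpotent_log {A : Type*} [CommRing A] [Algebra ℚ A] {x : A} (hx : IsNilpotent x) :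
    ∃ a, x ∣ a ∧ a ∣ x ∧ IsNilpotent.exp a = 1 + x := by
  obtain ⟨k, hk⟩ := hx
  obtain ⟨a, ⟨c, hc⟩, h2⟩ := exists_exp_approx ⟨k, hk⟩ k
  rw [pow_succ, hk, zero_mul, zero_dvd_iff, sub_eq_zero] at h2
  refine ⟨a, ⟨c, hc⟩, ?_, h2⟩
  obtain ⟨w, hw⟩ := exists_exp_eq_one_add
    (show IsNilpotent a from hc ▸ (Commute.all x c).isNilpotent_mul_right ⟨k, hk⟩)
  exact ⟨1 + a * w, by linear_combination hw - h2⟩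

theorem normedSpace_exp_eq {A : Type*} [NormedRing A] [NormedAlgebra ℂ A] [Algebra ℚ A]
    [CompleteSpace A] {a : A} (ha : IsNilpotent a) : NormedSpace.exp a = IsNilpotent.exp a := by
  obtain ⟨k, hk⟩ := ha
  rw [IsNilpotent.exp_eq_sum hk, NormedSpace.exp_eq_tsum ℚ]
  refine tsum_eq_sum fun n hn => ?_
  rw [Finset.mem_range, not_lt] at hn
  simp [pow_eq_zero_of_le hn hk]

/-- Unipotent elements of a Banach algebra have a nilpotent logarithm, which is a multiple of `x`
and divides it. The construction takes place in the commutative ring `ℂ[X] ⧸ (X ^ k)`, which maps to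
the algebra by `X ↦ x`. -/
theorem exists_exp_eq_one_add_of_isNilpotent {A : Type*} [NormedRing A] [NormedAlgebra ℂ A]
    [CompleteSpace A] {x : A} (hx : IsNilpotent x) :
    ∃ a, IsNilpotent a ∧ (∃ c, a = c * x) ∧ (∃ c, x = c * a) ∧ NormedSpace.exp a = 1 + x := by
  let _ : Algebra ℚ A := Algebra.compHom A (algebraMap ℚ ℂ)
  obtain ⟨k, hk⟩ := hx
  let R := Polynomial ℂ ⧸ Ideal.span {(Polynomial.X : Polynomial ℂ) ^ k}
  let f : R →+* A := Ideal.Quotient.lift _ (Polynomial.aeval x).toRingHom (by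
    intro p hp
    obtain ⟨q, rfl⟩ := Ideal.mem_span_singleton'.1 hp
    simp [hk])
  let ξ : R := Ideal.Quotient.mk _ Polynomial.X
  have hξ : f ξ = x := (Ideal.Quotient.lift_mk _ _ _).trans (Polynomial.aeval_X x)
  have hnil : IsNilpotent ξ := ⟨k, by
    rw [← map_pow, Ideal.Quotient.eq_zero_iff_mem]
    exact Ideal.mem_span_singleton_self _⟩
  obtain ⟨a, ⟨c, hc⟩, ⟨c', hc'⟩, he⟩ := exists_nilpotent_log hnil
  have ha : IsNilpotent a := hc ▸ (Commute.all ξ c).isNilpotent_mul_right hnil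
  refine ⟨f a, ha.map f, ⟨f c, ?_⟩, ⟨f c', ?_⟩, ?_⟩
  · rw [← hξ, ← map_mul, mul_comm, ← hc]
  · rw [← hξ, ← map_mul, mul_comm, ← hc']
  · rw [normedSpace_exp_eq (ha.map f), ← IsNilpotent.map_exp ha f, he, map_add, map_one, hξ]

end NilpotentLog

/-! ### Jordan bases of nilpotent endomorphisms -/

section Jordan

open Polynomial

variable {E : Type*} [AddCommGroup E] [Module ℂ E]

theorem isTorsion_aeval {N : Module.End ℂ E} (hN : IsNilpotent N) :
    Module.IsTorsion' (Module.AEval' N) (Submonoid.powers (X : ℂ[X])) := by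
  obtain ⟨k, hk⟩ := hN
  intro x
  refine ⟨⟨X ^ k, k, rfl⟩, ?_⟩
  have h := Module.AEval'.X_pow_smul_of N ((Module.AEval'.of N).symm x) k
  rw [hk, zero_smul, map_zero, LinearEquiv.apply_symm_apply] at h
  exact h

theorem dfinsupp_basis_apply {ι : Type*} [DecidableEq ι] {κ : ι → Type*} {M : ι → Type*}
    [∀ i, AddCommGroup (M i)] [∀ i, Module ℂ (M i)] (b : ∀ i, Module.Basis (κ i) ℂ (M i))
    (p : Σ i, κ i) : DFinsupp.basis b p = DFinsupp.single p.1 (b p.1 p.2) := by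
  classical
  rw [Module.Basis.apply_eq_iff]
  ext ⟨i, j⟩
  obtain ⟨i', j'⟩ := p
  by_cases h : i' = i
  · subst h
    simp [DFinsupp.basis, Finsupp.single_apply]
  · simp [DFinsupp.basis, h, Ne.symm h]

variable [FiniteDimensional ℂ E]

/-- Jordan strings: `E` has a basis `v (i, j)`, `j < k i`, with `N v (i, j) = v (i, j + 1)`, read as
`0` for `j + 1 = k i`. They come from the decomposition of `E`, a torsion module over `ℂ[X]` on
which `X` acts as `N`, into cyclic modules `ℂ[X] ⧸ (X ^ k i)`. -/
theorem exists_jordan_strings {N : Module.End ℂ E} (hN : IsNilpotent N) :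
    ∃ (d : ℕ) (k : Fin d → ℕ) (b : Module.Basis (Σ i, Fin (k i)) ℂ E) (g : Fin d → E),
      (∀ p, b p = (N ^ (p.2 : ℕ)) (g p.1)) ∧ ∀ i, (N ^ k i) (g i) = 0 := by
  obtain ⟨d, k, ⟨e⟩⟩ := Module.torsion_by_prime_power_decomposition (p := X)
    Polynomial.irreducible_X (isTorsion_aeval hN)
  have hdeg : ∀ i, ((X : ℂ[X]) ^ k i).natDegree = k i := fun i => natDegree_X_pow _
  let b0 : ∀ i, Module.Basis (Fin (k i)) ℂ (ℂ[X] ⧸ Submodule.span ℂ[X] {(X : ℂ[X]) ^ k i}) :=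
    fun i => (AdjoinRoot.powerBasis' (monic_X_pow (R := ℂ) (k i))).basis.reindex (finCongr (hdeg i))
  have hb0 : ∀ i j, b0 i j = (X : ℂ[X]) ^ (j : ℕ) •
      (Submodule.Quotient.mk 1 : ℂ[X] ⧸ Submodule.span ℂ[X] {(X : ℂ[X]) ^ k i}) := by
    intro i j
    have h := (AdjoinRoot.powerBasis' (monic_X_pow (R := ℂ) (k i))).basis_eq_pow
      ((finCongr (hdeg i)).symm j)
    rw [AdjoinRoot.powerBasis'_gen] at h
    refine ((Module.Basis.reindex_apply _ (finCongr (hdeg i)) j).trans h).trans ?_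
    rw [← Submodule.Quotient.mk_smul]
    show _ = AdjoinRoot.mk (X ^ k i : ℂ[X]) (X ^ (j : ℕ) • 1)
    rw [smul_eq_mul, mul_one, map_pow, AdjoinRoot.mk_X]
    rfl
  let e' : Module.AEval' N ≃ₗ[ℂ] (DirectSum (Fin d) fun i =>
    ℂ[X] ⧸ Submodule.span ℂ[X] {(X : ℂ[X]) ^ k i}) := e.restrictScalars ℂ
  let b : Module.Basis (Σ i, Fin (k i)) ℂ E :=
    (DFinsupp.basis b0).map (e'.symm.trans (Module.AEval'.of N).symm)
  let g : Fin d → E := fun i => (Module.AEval'.of N).symm (e.symm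
    (DirectSum.lof ℂ[X] (Fin d) (fun i => ℂ[X] ⧸ Submodule.span ℂ[X] {(X : ℂ[X]) ^ k i}) i
      (Submodule.Quotient.mk 1)))
  have hpow : ∀ i (l : ℕ), (N ^ l) (g i) = (Module.AEval'.of N).symm (e.symm
      (DirectSum.lof ℂ[X] (Fin d) (fun i => ℂ[X] ⧸ Submodule.span ℂ[X] {(X : ℂ[X]) ^ k i}) i
        ((X : ℂ[X]) ^ l • Submodule.Quotient.mk 1))) := by
    intro i l
    rw [map_smul, map_smul, LinearEquiv.eq_symm_apply]
    have h := Module.AEval'.X_pow_smul_of N (g i) l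
    rw [LinearEquiv.apply_symm_apply] at h
    exact h.symm
  refine ⟨d, k, b, g, fun p => ?_, fun i => ?_⟩
  · rw [hpow, ← hb0]
    show (Module.AEval'.of N).symm (e.symm (DFinsupp.basis b0 p)) = _
    congr 2
    exact dfinsupp_basis_apply b0 p
  · rw [hpow]
    have : (X : ℂ[X]) ^ k i •
      (Submodule.Quotient.mk 1 : ℂ[X] ⧸ Submodule.span ℂ[X] {(X : ℂ[X]) ^ k i}) = 0 := by
      rw [← Submodule.Quotient.mk_smul, Submodule.Quotient.mk_eq_zero]
      simp
    rw [this, map_zero, map_zero, map_zero]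

/-- The range of `N` is spanned by the basis vectors `b (i - 1)`, `i ∉ heads`, so that rank–nullity
counts the heads. -/
theorem card_heads_eq_finrank_ker {N : Module.End ℂ E} {m : ℕ} (b : Module.Basis (Fin m) ℂ E)
    (heads : Finset (Fin m)) (h0 : ∀ i : Fin m, (i : ℕ) = 0 → i ∈ heads)
    (h1 : ∀ i ∈ heads, N (b i) = 0)
    (h2 : ∀ i ∉ heads, N (b i) = b ⟨i - 1, (Nat.sub_le _ _).trans_lt i.2⟩) :
    heads.card = Module.finrank ℂ (LinearMap.ker N) := by
  have hr : LinearMap.range N = Submodule.span ℂ (Set.range fun i : {i // i ∉ heads} =>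
      b ⟨(i : Fin m) - 1, (Nat.sub_le _ _).trans_lt i.1.2⟩) := by
    rw [LinearMap.range_eq_map, ← b.span_eq, Submodule.map_span]
    apply le_antisymm <;> rw [Submodule.span_le]
    · rintro _ ⟨_, ⟨i, rfl⟩, rfl⟩
      by_cases hi : i ∈ heads
      · rw [h1 i hi]; exact zero_mem _
      · rw [h2 i hi]; exact Submodule.subset_span ⟨⟨i, hi⟩, rfl⟩
    · rintro _ ⟨i, rfl⟩
      exact Submodule.subset_span ⟨b i, ⟨i, rfl⟩, h2 i i.2⟩
  have hinj : Function.Injective fun i : {i // i ∉ heads} =>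
      (⟨(i : Fin m) - 1, (Nat.sub_le _ _).trans_lt i.1.2⟩ : Fin m) := by
    rintro ⟨i, hi⟩ ⟨j, hj⟩ hij
    have hi' : (i : ℕ) ≠ 0 := fun h => hi (h0 i h)
    have hj' : (j : ℕ) ≠ 0 := fun h => hj (h0 j h)
    have : (i : ℕ) - 1 = j - 1 := congrArg Fin.val hij
    exact Subtype.ext (Fin.ext (by simp only; omega))
  have hrank : Module.finrank ℂ (LinearMap.range N) = m - heads.card := by
    have h := finrank_span_eq_card (b.linearIndependent.comp _ hinj)
    rw [Fintype.card_subtype_compl] at h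
    rw [hr]
    simpa [Function.comp_def] using h
  have h3 := N.finrank_range_add_finrank_ker
  have h4 : Module.finrank ℂ E = m := by simp [Module.finrank_eq_card_basis b]
  have h5 : heads.card ≤ m := by simpa using heads.card_le_univ
  omega

/-- The Jordan normal form of a nilpotent endomorphism, the Jordan chains being listed one after the
other, each beginning with its vector in the kernel. Since `0` is a head, the subtraction `i - 1`
never truncates. -/
theorem exists_jordan_basis {N : Module.End ℂ E} (hN : IsNilpotent N) {m : ℕ}
    (hm : Module.finrank ℂ E = m) :
    ∃ (heads : Finset (Fin m)) (b : Module.Basis (Fin m) ℂ E),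
      (∀ i : Fin m, (i : ℕ) = 0 → i ∈ heads) ∧ (∀ i ∈ heads, N (b i) = 0) ∧
      (∀ i ∉ heads, N (b i) = b ⟨i - 1, (Nat.sub_le _ _).trans_lt i.2⟩) ∧
      heads.card = Module.finrank ℂ (LinearMap.ker N) := by
  obtain ⟨d, k, b, g, hb, hg⟩ := exists_jordan_strings hN
  have hmk : m = ∑ i, k i := by
    rw [← hm, Module.finrank_eq_card_basis b]; simp
  subst hmk
  -- each string is listed from its end, the kernel vector
  let r : (Σ i, Fin (k i)) ≃ Fin (∑ i, k i) :=
    (Equiv.sigmaCongrRight fun i => Fin.revPerm).trans finSigmaFinEquiv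
  let B := b.reindex r
  have hB : ∀ (i : Fin d) (j : Fin (k i)),
      B (finSigmaFinEquiv ⟨i, j⟩) = (N ^ (k i - (j + 1))) (g i) := by
    intro i j
    have : r.symm (finSigmaFinEquiv ⟨i, j⟩) = ⟨i, Fin.rev j⟩ := by
      rw [Equiv.symm_apply_eq]; simp [r]
    rw [Module.Basis.reindex_apply, this, hb, Fin.val_rev]
  let P : (Σ i, Fin (k i)) → Prop := fun p => (p.2 : ℕ) = 0
  let heads : Finset (Fin (∑ i, k i)) :=
    Finset.univ.filter fun i => P (finSigmaFinEquiv.symm i)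
  have hmem : ∀ (i : Fin d) (j : Fin (k i)), finSigmaFinEquiv ⟨i, j⟩ ∈ heads ↔ (j : ℕ) = 0 := by
    intro i j
    rw [Finset.mem_filter, Equiv.symm_apply_apply]
    simp [P]
  have H0 : ∀ i : Fin (∑ i, k i), (i : ℕ) = 0 → i ∈ heads := by
    intro q hq
    obtain ⟨⟨i, j⟩, rfl⟩ := finSigmaFinEquiv.surjective q
    rw [finSigmaFinEquiv_apply] at hq
    simp only at hq
    rw [hmem]
    omega
  have H1 : ∀ i ∈ heads, N (B i) = 0 := by
    intro q hq
    obtain ⟨⟨i, j⟩, rfl⟩ := finSigmaFinEquiv.surjective q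
    rw [hmem] at hq
    rw [hB, ← Module.End.mul_apply, ← pow_succ', hq]
    have := j.2
    rw [show k i - (0 + 1) + 1 = k i by omega, hg]
  have H2 : ∀ i ∉ heads, N (B i) = B ⟨i - 1, (Nat.sub_le _ _).trans_lt i.2⟩ := by
    intro q hq
    obtain ⟨⟨i, j⟩, rfl⟩ := finSigmaFinEquiv.surjective q
    rw [hmem] at hq
    have hj := j.2
    have e : (⟨(finSigmaFinEquiv ⟨i, j⟩ : Fin _) - 1,
        (Nat.sub_le _ _).trans_lt (finSigmaFinEquiv ⟨i, j⟩).2⟩ : Fin (∑ i, k i)) =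
        finSigmaFinEquiv ⟨i, ⟨j - 1, (Nat.sub_le _ _).trans_lt hj⟩⟩ := by
      ext
      simp only [finSigmaFinEquiv_apply]
      omega
    rw [e, hB, hB, ← Module.End.mul_apply, ← pow_succ']
    congr 2
    simp only
    omega
  exact ⟨heads, B, H0, H1, H2, card_heads_eq_finrank_ker B heads H0 H1 H2⟩

end Jordan

/-! ### Solution operators and entire solutions -/

section Evolution

set_option linter.unusedSectionVars false

variable {h : ℝ} {V : Type*} [NormedAddCommGroup V] [NormedSpace ℂ V]
  {L : ℝ → HistorySpace h V →L[ℂ] V}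

open scoped BoundedContinuousFunction

theorem IsSolution.restart {s r : ℝ} {φ : HistorySpace h V} {y : C(ℝ, V)}
    (hy : IsSolution L s φ y) (hr : s ≤ r) : IsSolution L r (hist h y r) y :=
  ⟨rfl, fun t ht => (hy.eqn t (hr.trans ht)).mono (Ici_subset_Ici.2 hr)⟩

variable (h V) in
/-- `y ↦ y_t` as a linear map. -/
def histLinear (t : ℝ) : C(ℝ, V) →ₗ[ℂ] HistorySpace h V where
  toFun y := hist h y t
  map_add' _ _ := rfl
  map_smul' _ _ := rfl

/-- Translation of `y` by `a`. -/
def translate (a : ℝ) (y : C(ℝ, V)) : C(ℝ, V) := ⟨fun t => y (t + a), by fun_prop⟩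

theorem hist_translate (a : ℝ) (y : C(ℝ, V)) (t : ℝ) :
    hist h (translate a y) t = hist h y (t + a) := by
  ext θ
  show y (t + θ + a) = y (t + a + θ)
  rw [add_right_comm]

theorem IsSolution.translate {s a : ℝ} {φ : HistorySpace h V} {y : C(ℝ, V)}
    (ha : Function.Periodic L a) (hy : IsSolution L (s + a) φ y) :
    IsSolution L s φ (translate a y) := by
  refine ⟨by rw [hist_translate, hy.init], fun t ht => ?_⟩
  have h1 := hy.eqn (t + a) (by linarith)
  rw [hist_translate, ← ha t]
  have h2 : HasDerivWithinAt (fun t : ℝ => t + a) 1 (Ici s) t :=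
    ((hasDerivAt_id t).add_const a).hasDerivWithinAt
  have h3 := h1.scomp t h2 (fun x (hx : s ≤ x) => show s + a ≤ x + a by linarith)
  rwa [one_smul] at h3

/-- `y` solves `y'(t) = L(t) y_t` on the whole line. -/
def IsEntireSolution (L : ℝ → HistorySpace h V →L[ℂ] V) (y : C(ℝ, V)) : Prop :=
  ∀ t, HasDerivAt y (L t (hist h y t)) t

theorem IsEntireSolution.isSolution {y : C(ℝ, V)} (hy : IsEntireSolution L y) (s : ℝ) :
    IsSolution L s (hist h y s) y :=
  ⟨rfl, fun t _ => (hy t).hasDerivWithinAt⟩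

theorem IsEntireSolution.translate {a : ℝ} {y : C(ℝ, V)} (ha : Function.Periodic L a)
    (hy : IsEntireSolution L y) : IsEntireSolution L (translate a y) := by
  intro t
  rw [hist_translate, ← ha t]
  exact (hy (t + a)).comp_add_const t a

variable [Fact (0 < h)]

theorem eq_of_hist_eq {y z : C(ℝ, V)} {t : ℝ} (H : hist h y t = hist h z t) : y t = z t := by
  simpa [hist, zeroPt] using congrArg (fun f => f (zeroPt h)) H

theorem eq_of_hist_eq' {y z : C(ℝ, V)} {t x : ℝ} (H : hist h y t = hist h z t)
    (h1 : t - h ≤ x) (h2 : x ≤ t) : y x = z x := by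
  have := congrArg (fun f => f ⟨x - t, by linarith, by linarith⟩) H
  simpa [hist] using this

variable [CompleteSpace V]

theorem evolution_eq (hL : Continuous L) {M : ℝ} (hM : ∀ t, ‖L t‖ ≤ M) {s t : ℝ} (hst : s ≤ t)
    {φ : HistorySpace h V} {y : C(ℝ, V)} (hy : IsSolution L s φ y) :
    evolution L t s φ = hist h y t := by
  obtain ⟨z, hz, hU⟩ := evolution_spec hL hM t s φ
  rw [hU, solution_unique hM hst hz hy]

theorem exists_isSolution (hL : Continuous L) {M : ℝ} (hM : ∀ t, ‖L t‖ ≤ M) (s : ℝ)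
    (φ : HistorySpace h V) : ∃ y : C(ℝ, V), IsSolution L s φ y :=
  let ⟨y, hy, _⟩ := evolution_spec hL hM s s φ
  ⟨y, hy⟩

theorem evolution_apply_evolution (hL : Continuous L) {M : ℝ} (hM : ∀ t, ‖L t‖ ≤ M) {s r t : ℝ}
    (hsr : s ≤ r) (hrt : r ≤ t) (φ : HistorySpace h V) :
    evolution L t r (evolution L r s φ) = evolution L t s φ := by
  obtain ⟨y, hy⟩ := exists_isSolution hL hM s φ
  rw [evolution_eq hL hM hsr hy, evolution_eq hL hM hrt (hy.restart hsr),
    evolution_eq hL hM (hsr.trans hrt) hy]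

theorem evolution_add_period (hL : Continuous L) {M : ℝ} (hM : ∀ t, ‖L t‖ ≤ M) {a : ℝ}
    (ha : Function.Periodic L a) {s t : ℝ} (hst : s ≤ t) :
    evolution L (t + a) (s + a) = evolution L t s := by
  ext1 φ
  obtain ⟨y, hy⟩ := exists_isSolution hL hM (s + a) φ
  rw [evolution_eq hL hM (by linarith) hy, evolution_eq hL hM hst (hy.translate ha),
    hist_translate]

theorem evolution_pow (hL : Continuous L) {M : ℝ} (hM : ∀ t, ‖L t‖ ≤ M) {T : ℝ} (hT : 0 < T)
    (hper : Function.Periodic L T) (s : ℝ) (j : ℕ) (hj : j ≠ 0) :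
    evolution L (s + T) s ^ j = evolution L (s + j * T) s := by
  obtain ⟨j, rfl⟩ := Nat.exists_eq_succ_of_ne_zero hj
  clear hj
  induction j with
  | zero => simp
  | succ j ih =>
    rw [pow_succ, ih]
    ext1 φ
    have h1 := evolution_add_period hL hM hper (s := s) (t := s + (j + 1 : ℕ) * T)
      (by have : (0 : ℝ) ≤ (j + 1 : ℕ) * T := by positivity
          linarith)
    show evolution L (s + (j + 1 : ℕ) * T) s (evolution L (s + T) s φ) = _
    rw [← h1, evolution_apply_evolution hL hM (by linarith)
      (by have : (0 : ℝ) ≤ (j + 1 : ℕ) * T := by positivity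
          linarith)]
    congr 2
    push_cast; ring

/-- Arzelà–Ascoli for uniformly bounded, uniformly Lipschitz histories. -/
theorem exists_isCompact_lipschitz_ball [ProperSpace V] (C : ℝ) (K : NNReal) :
    ∃ S : Set (HistorySpace h V), IsCompact S ∧
      ∀ f : HistorySpace h V, ‖f‖ ≤ C → LipschitzWith K f → f ∈ S := by
  let A : Set (Icc (-h) (0 : ℝ) →ᵇ V) := {f | ‖f‖ ≤ C ∧ LipschitzWith K f}
  have hA : IsCompact (closure A) := by
    refine BoundedContinuousFunction.arzela_ascoli (Metric.closedBall (0 : V) C)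
      (isCompact_closedBall _ _) A (fun f x hf => ?_) ?_
    · rw [mem_closedBall_zero_iff]
      exact (f.norm_coe_le_norm x).trans hf.1
    · exact (LipschitzWith.uniformEquicontinuous _ K fun f => f.2.2).equicontinuous
  let e := ContinuousMap.isometryEquivBoundedOfCompact (Icc (-h) (0 : ℝ)) V
  refine ⟨e.symm '' closure A, hA.image e.symm.continuous, fun f hf1 hf2 => ?_⟩
  exact ⟨e f, subset_closure ⟨by simpa [e] using hf1, hf2⟩, e.symm_apply_apply f⟩

/-- The solution operators are compact after one delay time: by then the initial function has left
the history, which therefore is Lipschitz with a constant controlled by the norm of the solution. -/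
theorem isCompactOperator_evolution [ProperSpace V] (hL : Continuous L) {M : ℝ}
    (hM : ∀ t, ‖L t‖ ≤ M) {s t : ℝ} (hst : s + h ≤ t) :
    IsCompactOperator (evolution L t s) := by
  have hh : (0 : ℝ) < h := Fact.out
  have hM0 : 0 ≤ M := (norm_nonneg (L 0)).trans (hM 0)
  -- one bound for the solutions on all of `[s, t]`, by uniform boundedness
  obtain ⟨C, hC⟩ := banach_steinhaus (g := fun τ : Icc s t => evolution L τ s) (fun φ => by
    obtain ⟨y, hy⟩ := exists_isSolution hL hM s φ
    obtain ⟨C, hC⟩ := isCompact_Icc.exists_bound_of_continuousOn (s := Icc s t)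
      (hist_continuous (h := h) y).continuousOn
    exact ⟨C, fun τ => by rw [evolution_eq hL hM τ.2.1 hy]; exact hC τ τ.2⟩)
  have hC0 : 0 ≤ C := (norm_nonneg _).trans (hC ⟨s, le_rfl, by linarith⟩)
  obtain ⟨S, hS, hS'⟩ := exists_isCompact_lipschitz_ball (h := h) (V := V) C
    (⟨M * C, by positivity⟩ : NNReal)
  refine ⟨S, hS, mem_of_superset (Metric.closedBall_mem_nhds 0 one_pos) fun φ hφ => ?_⟩
  rw [mem_closedBall_zero_iff] at hφ
  obtain ⟨y, hy⟩ := exists_isSolution hL hM s φ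
  have hb : ∀ τ ∈ Icc s t, ‖hist h y τ‖ ≤ C := by
    intro τ hτ
    rw [← evolution_eq hL hM hτ.1 hy]
    exact ((evolution L τ s).le_of_opNorm_le_of_le (hC ⟨τ, hτ⟩) hφ).trans (by simp)
  rw [mem_preimage, evolution_eq hL hM (by linarith) hy]
  refine hS' _ (hb t ⟨by linarith, le_rfl⟩) (LipschitzWith.of_dist_le_mul fun θ θ' => ?_)
  rw [dist_eq_norm, Subtype.dist_eq, dist_eq_norm]
  have h1 := (convex_Icc s t).norm_image_sub_le_of_norm_hasDerivWithin_le (f := y)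
    (f' := fun τ => L τ (hist h y τ)) (C := M * C) (x := t + θ') (y := t + θ)
    (fun τ hτ => (hy.eqn τ hτ.1).mono Icc_subset_Ici_self)
    (fun τ hτ => (L τ).le_of_opNorm_le_of_le (hM τ) (hb τ hτ))
    ⟨by linarith [θ'.2.1], by linarith [θ'.2.2]⟩ ⟨by linarith [θ.2.1], by linarith [θ.2.2]⟩
  rw [add_sub_add_left_eq_sub] at h1
  exact h1

/-- Entire solutions agree as soon as they agree on histories arbitrarily far in the past. -/
theorem IsEntireSolution.eq_of_frequently {M : ℝ} (hM : ∀ t, ‖L t‖ ≤ M) {y z : C(ℝ, V)}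
    (hy : IsEntireSolution L y) (hz : IsEntireSolution L z)
    (H : ∃ᶠ t in atBot, hist h y t = hist h z t) : y = z := by
  ext t
  obtain ⟨r, hr, hr'⟩ := (H.and_eventually (eventually_le_atBot t)).exists
  refine eq_of_hist_eq (solution_unique hM hr' (φ := hist h y r) (hy.isSolution r) ?_)
  rw [hr]
  exact hz.isSolution r

/-- A backward orbit of the period map extends to an entire solution. -/
theorem exists_entireSolution (hL : Continuous L) {M : ℝ} (hM : ∀ t, ‖L t‖ ≤ M) {T : ℝ}
    (hT : 0 < T) (hper : Function.Periodic L T) (s : ℝ) (w : ℕ → HistorySpace h V)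
    (hw : ∀ j, evolution L (s + T) s (w (j + 1)) = w j) :
    ∃ y : C(ℝ, V), IsEntireSolution L y ∧ ∀ j : ℕ, hist h y (s - j * T) = w j := by
  have hh : (0 : ℝ) < h := Fact.out
  have hz : ∀ j : ℕ, ∃ z : C(ℝ, V), IsSolution L (s - j * T) (w j) z := fun j =>
    exists_isSolution hL hM _ _
  choose z hz using hz
  have hT' : ∀ j : ℕ, s - (j + 1 : ℕ) * T = s - j * T - T := fun j => by push_cast; ring
  -- the solutions started at successive points of the orbit are extensions of each other
  have hstep : ∀ j : ℕ, hist h (z (j + 1)) (s - j * T) = w j := by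
    intro j
    have h1 : evolution L (s - j * T) (s - (j + 1 : ℕ) * T) = evolution L (s + T) s := by
      have := evolution_add_period hL hM (hper.nat_mul (j + 1)) (s := s - (j + 1 : ℕ) * T)
        (t := s - j * T) (by rw [hT']; linarith)
      rw [← this]
      congr 1 <;> push_cast <;> ring
    rw [← hw j, ← h1]
    exact (evolution_eq hL hM (by rw [hT']; linarith) (hz (j + 1))).symm
  have hstep' : ∀ (j : ℕ) t, s - j * T - h ≤ t → z (j + 1) t = z j t := by
    intro j t ht
    rcases le_total t (s - j * T) with h1 | h1
    · refine eq_of_hist_eq' (h := h) ?_ ht h1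
      rw [hstep, (hz j).init]
    · refine eq_of_hist_eq (solution_unique hM h1 (φ := w j) ?_ (hz j))
      have := (hz (j + 1)).restart (r := s - j * T) (by rw [hT']; linarith)
      rwa [hstep] at this
  have hext : ∀ (j i : ℕ) t, s - j * T - h ≤ t → z (j + i) t = z j t := by
    intro j i t ht
    induction i with
    | zero => rfl
    | succ i ih =>
      rw [← add_assoc, hstep', ih]
      push_cast
      have : 0 ≤ (i : ℝ) * T := by positivity
      linarith
  -- the `J t`-th of these solutions is defined at time `t`
  let J : ℝ → ℕ := fun t => ⌈(s - t) / T⌉₊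
  have hJ : ∀ t, s - J t * T ≤ t := by
    intro t
    have := Nat.le_ceil ((s - t) / T)
    rw [div_le_iff₀ hT] at this
    linarith
  let f : ℝ → V := fun t => z (J t) t
  have hf : ∀ (j : ℕ) t, s - j * T - h ≤ t → f t = z j t := by
    intro j t ht
    show z (J t) t = z j t
    have h1 := hext j (J t) t ht
    have h2 := hext (J t) j t (by linarith [hJ t])
    rw [← h1, ← h2, add_comm]
  have hloc : ∀ t, ∃ j : ℕ, s - j * T < t := by
    intro t
    obtain ⟨j, hj⟩ := exists_nat_gt ((s - t) / T)
    rw [div_lt_iff₀ hT] at hj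
    exact ⟨j, by linarith⟩
  have hev : ∀ (j : ℕ) t, s - j * T < t → f =ᶠ[𝓝 t] z j := by
    intro j t ht
    filter_upwards [lt_mem_nhds ht] with x hx
    exact hf j x (by linarith)
  have hcont : Continuous f := continuous_iff_continuousAt.2 fun t => by
    obtain ⟨j, hj⟩ := hloc t
    exact (z j).continuous.continuousAt.congr (hev j t hj).symm
  have hhist : ∀ (j : ℕ) t, s - j * T ≤ t → hist h ⟨f, hcont⟩ t = hist h (z j) t := by
    intro j t ht
    ext θ
    exact hf j _ (by linarith [θ.2.1])
  refine ⟨⟨f, hcont⟩, fun t => ?_, fun j => ?_⟩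
  · obtain ⟨j, hj⟩ := hloc t
    rw [hhist j t hj.le]
    exact (((hz j).eqn t hj.le).hasDerivAt (Ici_mem_nhds hj)).congr_of_eventuallyEq (hev j t hj)
  · rw [hhist j _ le_rfl, (hz j).init]

/-- The flow of entire solutions through a finite-dimensional subspace on which the period map
is invertible. A translation by the period amounts to an application of the period map. -/
theorem exists_floquet_flow (hL : Continuous L) {M : ℝ} (hM : ∀ t, ‖L t‖ ≤ M) {T : ℝ}
    (hT : 0 < T) (hper : Function.Periodic L T) (s : ℝ) (W : Submodule ℂ (HistorySpace h V))
    [FiniteDimensional ℂ W] (A : W ≃ₗ[ℂ] W)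
    (hA : ∀ w, (A w : HistorySpace h V) = evolution L (s + T) s w) :
    ∃ Y : W →ₗ[ℂ] C(ℝ, V), (∀ w, IsEntireSolution L (Y w)) ∧ (∀ w, hist h (Y w) s = w) ∧
      ∀ w t, Y w (t + T) = Y (A w) t := by
  let b := Module.finBasis ℂ W
  have hy : ∀ i, ∃ y : C(ℝ, V), IsEntireSolution L y ∧
      ∀ j : ℕ, hist h y (s - j * T) = (((A.symm : W →ₗ[ℂ] W) ^ j) (b i) : W) := fun i =>
    exists_entireSolution hL hM hT hper s _ fun j => by
      rw [← hA, pow_succ', Module.End.mul_apply]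
      exact congrArg _ (A.apply_symm_apply _)
  choose y hy1 hy2 using hy
  let Y : W →ₗ[ℂ] C(ℝ, V) := b.constr ℂ y
  have hY : ∀ w, Y w = ∑ i, b.repr w i • y i := fun w => by
    rw [Module.Basis.constr_apply_fintype]; rfl
  have hhist : ∀ w t, hist h (Y w) t = ∑ i, b.repr w i • hist h (y i) t := by
    intro w t
    rw [hY]
    ext θ
    show (∑ i, b.repr w i • y i : C(ℝ, V)) (t + θ) =
      (∑ i, b.repr w i • hist h (y i) t : HistorySpace h V) θ
    rw [ContinuousMap.sum_apply, ContinuousMap.sum_apply]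
    rfl
  have hent : ∀ w, IsEntireSolution L (Y w) := by
    intro w t
    rw [hhist, map_sum]
    simp only [map_smul]
    have : ⇑(Y w) = fun t => ∑ i, b.repr w i • y i t := by
      ext t; rw [hY, ContinuousMap.sum_apply]; rfl
    rw [this]
    exact HasDerivAt.fun_sum fun i _ => (hy1 i t).const_smul _
  have hback : ∀ w (j : ℕ), hist h (Y w) (s - j * T) = (((A.symm : W →ₗ[ℂ] W) ^ j) w : W) := by
    intro w j
    rw [hhist]
    conv_rhs => rw [← b.sum_repr w]
    simp only [hy2, map_sum, map_smul, Submodule.coe_sum, Submodule.coe_smul]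
  refine ⟨Y, hent, fun w => by simpa using hback w 0, fun w t => ?_⟩
  -- both sides are entire solutions with the same histories at the times `s - (j + 1) T`
  suffices translate T (Y w) = Y (A w) from congrArg (fun f => f t) this
  refine ((hent w).translate hper).eq_of_frequently hM (hent (A w)) ?_
  have hseq : Tendsto (fun j : ℕ => s - (j + 1 : ℕ) * T) atTop atBot := by
    refine tendsto_atBot_mono (g := fun j : ℕ => s - (j + 1 : ℕ) * T)
      (f := fun j : ℕ => s + (-(T * j))) (fun j => ?_) ?_
    · push_cast; nlinarith
    · exact tendsto_atBot_add_const_left _ _ (tendsto_neg_atTop_atBot.comp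
        (tendsto_natCast_atTop_atTop.const_mul_atTop hT))
  refine hseq.frequently (Frequently.of_forall fun j => ?_)
  rw [hist_translate, hback, show s - ((j + 1 : ℕ) : ℝ) * T + T = s - j * T by push_cast; ring,
    hback, pow_succ, Module.End.mul_apply]
  congr 2
  exact (A.symm_apply_apply w).symm

end Evolution

/-! ### Smoothness of solutions -/

section Smoothness

/-- Differentiability of `t ↦ y_t` in the supremum norm, because this curve is the integral of the
continuous curve `t ↦ (y')_t`. -/
theorem hasDerivAt_hist {h : ℝ} {V : Type*} [NormedAddCommGroup V] [NormedSpace ℝ V]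
    [CompleteSpace V] {y y' : C(ℝ, V)} (hy : ∀ t, HasDerivAt y (y' t) t) (t : ℝ) :
    HasDerivAt (hist h y) (hist h y' t) t := by
  have hc : Continuous (hist h y') := hist_continuous y'
  have e : hist h y = fun t => hist h y 0 + ∫ u in (0 : ℝ)..t, hist h y' u := by
    ext t θ
    have h1 := (ContinuousMap.evalCLM ℝ θ : HistorySpace h V →L[ℝ] V).intervalIntegral_comp_comm
      (hc.intervalIntegrable (μ := MeasureTheory.volume) 0 t)
    have h2 : ∫ u in (0 : ℝ)..t, y' (u + θ) = y (t + θ) - y (0 + θ) :=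
      intervalIntegral.integral_eq_sub_of_hasDerivAt (f := fun u => y (u + θ))
        (fun u _ => (hy (u + θ)).comp_add_const u θ)
        ((by fun_prop : Continuous fun u : ℝ => y' (u + θ)).intervalIntegrable _ _)
    show y (t + θ) = y (0 + θ) + (ContinuousMap.evalCLM ℝ θ : HistorySpace h V →L[ℝ] V)
      (∫ u in (0 : ℝ)..t, hist h y' u)
    rw [← h1]
    show _ = _ + ∫ u in (0 : ℝ)..t, y' (u + θ)
    rw [h2]; abel
  rw [e]
  exact (intervalIntegral.integral_hasDerivAt_right (hc.intervalIntegrable _ _)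
    (hc.stronglyMeasurableAtFilter _ _) hc.continuousAt).const_add _

theorem contDiff_hist {h : ℝ} {V : Type*} [NormedAddCommGroup V] [NormedSpace ℝ V]
    [CompleteSpace V] {j : ℕ} {y : C(ℝ, V)} (hy : ContDiff ℝ j y) : ContDiff ℝ j (hist h y) := by
  induction j generalizing y with
  | zero => exact contDiff_zero.2 (hist_continuous y)
  | succ j ih =>
    have hy2 := (contDiff_succ_iff_deriv (n := j) (f := y)).1 (by exact_mod_cast hy)
    let y' : C(ℝ, V) := ⟨deriv y, hy2.2.2.continuous⟩
    have hd := hasDerivAt_hist (h := h) (y' := y') fun t => (hy2.1 t).hasDerivAt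
    have : ContDiff ℝ ((j : WithTop ℕ∞) + 1) (hist h y) := by
      rw [contDiff_succ_iff_deriv]
      refine ⟨fun t => (hd t).differentiableAt, by simp, ?_⟩
      rw [show deriv (hist h y) = hist h y' from funext fun t => (hd t).deriv]
      exact ih hy2.2.2
    exact_mod_cast this

variable {h : ℝ} {V : Type*} [NormedAddCommGroup V] [NormedSpace ℂ V] [CompleteSpace V]
  {L : ℝ → HistorySpace h V →L[ℂ] V}

/-- Solutions gain one derivative over the coefficients. -/
theorem IsEntireSolution.contDiff {k : ℕ} (hL : ContDiff ℝ k L) {y : C(ℝ, V)}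
    (hy : IsEntireSolution L y) : ContDiff ℝ (k + 1 : ℕ) y := by
  have hres : ContDiff ℝ k fun ℓ : HistorySpace h V →L[ℂ] V => ℓ.restrictScalars ℝ :=
    ContinuousLinearMap.contDiff (𝕜 := ℝ) (E := HistorySpace h V →L[ℂ] V)
      (F := HistorySpace h V →L[ℝ] V)
      (ContinuousLinearMap.restrictScalarsL ℂ (HistorySpace h V) V ℝ ℝ)
  have hL' : ContDiff ℝ k fun t => (L t).restrictScalars ℝ := hres.comp hL
  suffices ∀ j ≤ k + 1, ContDiff ℝ j y from this (k + 1) le_rfl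
  intro j hj
  induction j with
  | zero => exact contDiff_zero.2 y.continuous
  | succ j ih =>
    have ih := ih (by omega)
    have : ContDiff ℝ ((j : WithTop ℕ∞) + 1) y := by
      rw [contDiff_succ_iff_deriv]
      refine ⟨fun t => (hy t).differentiableAt, by simp, ?_⟩
      rw [show deriv y = fun t => (L t).restrictScalars ℝ (hist h y t) from
        funext fun t => (hy t).deriv]
      exact (hL'.of_le (by exact_mod_cast (by omega : j ≤ k))).clm_apply (contDiff_hist ih)
    exact_mod_cast this

/-- The equation of an entire solution in the history space. -/
theorem IsEntireSolution.exists_hasDerivAt_hist [Fact (0 < h)] (hL : Continuous L) {y : C(ℝ, V)}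
    (hy : IsEntireSolution L y) (t : ℝ) :
    ∃ ψ, HasDerivAt (hist h y) ψ t ∧ (hist h y t, ψ) ∈ generator (L t) := by
  let y' : C(ℝ, V) := ⟨fun t => L t (hist h y t), continuous_integrand hL y⟩
  refine ⟨hist h y' t, hasDerivAt_hist (y' := y') hy t, mem_generator_iff.2 ⟨?_, ?_⟩⟩
  · refine isHistDeriv_of_hasDerivAt (G := fun x => y (t + x)) (fun θ => ?_) fun θ => rfl
    exact (hy (t + θ)).comp_const_add t θ
  · show L (t + 0) (hist h y (t + 0)) = _
    rw [add_zero]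

end Smoothness

/-! ### Smoothness of the linearization -/

section Linearization

variable {n : ℕ} {h : ℝ}

theorem contDiff_complexify {j : ℕ} : ContDiff ℝ j (complexify (n := n) (h := h)) := by
  let c : (HistorySpace h (EuclideanSpace ℝ (Fin n)) →L[ℝ] EuclideanSpace ℝ (Fin n)) →L[ℝ]
      HistorySpace h (EuclideanSpace ℂ (Fin n)) →L[ℂ] EuclideanSpace ℂ (Fin n) :=
    { toFun := complexify
      map_add' := fun a b => by
        ext φ : 1
        simp only [complexify, ContinuousLinearMap.coe_mk', LinearMap.coe_mk, AddHom.coe_mk,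
          add_apply, map_add, smul_add]
        abel
      map_smul' := fun r a => by
        ext φ : 1
        simp only [complexify, ContinuousLinearMap.coe_mk', LinearMap.coe_mk, AddHom.coe_mk,
          smul_apply, map_smul, RingHom.id_apply, smul_add, smul_comm r Complex.I]
      cont := complexify_continuous }
  exact ContinuousLinearMap.contDiff (𝕜 := ℝ)
    (E := HistorySpace h (EuclideanSpace ℝ (Fin n)) →L[ℝ] EuclideanSpace ℝ (Fin n))
    (F := HistorySpace h (EuclideanSpace ℂ (Fin n)) →L[ℂ] EuclideanSpace ℂ (Fin n)) c

/-- The periodic solution inherits the smoothness of `F`, by bootstrapping. -/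
theorem IsPeriodicSolution.contDiff {F : HistorySpace h (EuclideanSpace ℝ (Fin n)) →
    EuclideanSpace ℝ (Fin n)} {k : ℕ} (hF : ContDiff ℝ k F) {γ : C(ℝ, EuclideanSpace ℝ (Fin n))}
    {T : ℝ} (hγ : IsPeriodicSolution F γ T) : ContDiff ℝ k γ := by
  suffices ∀ j ≤ k, ContDiff ℝ j γ from this k le_rfl
  intro j hj
  induction j with
  | zero => exact contDiff_zero.2 γ.continuous
  | succ j ih =>
    have ih := ih (by omega)
    have : ContDiff ℝ ((j : WithTop ℕ∞) + 1) γ := by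
      rw [contDiff_succ_iff_deriv]
      refine ⟨fun t => (hγ.eqn t).differentiableAt, by simp, ?_⟩
      rw [show deriv γ = fun t => F (hist h γ t) from funext fun t => (hγ.eqn t).deriv]
      exact (hF.of_le (by exact_mod_cast (by omega : j ≤ k))).comp (contDiff_hist ih)
    exact_mod_cast this

theorem contDiff_linearization {F : HistorySpace h (EuclideanSpace ℝ (Fin n)) →
    EuclideanSpace ℝ (Fin n)} {k : ℕ} (hF : ContDiff ℝ (k + 1) F)
    {γ : C(ℝ, EuclideanSpace ℝ (Fin n))} {T : ℝ} (hγ : IsPeriodicSolution F γ T) :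
    ContDiff ℝ k (linearization F γ) :=
  contDiff_complexify.comp ((hF.fderiv_right le_rfl).comp
    (contDiff_hist (hγ.contDiff (hF.of_le le_self_add))))

theorem linearization_periodic {F : HistorySpace h (EuclideanSpace ℝ (Fin n)) →
    EuclideanSpace ℝ (Fin n)} {γ : C(ℝ, EuclideanSpace ℝ (Fin n))} {T : ℝ}
    (hγ : IsPeriodicSolution F γ T) : Function.Periodic (linearization F γ) T := by
  intro t
  have : hist h γ (t + T) = hist h γ t := by
    ext1 θ
    show γ (t + T + θ) = γ (t + θ)
    rw [add_right_comm, hγ.periodic]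
  rw [linearization, linearization, this]

end Linearization

/-! ### Floquet normal form over a finite-dimensional space -/

section Exponential

variable {W : Type*} [NormedAddCommGroup W] [NormedSpace ℂ W] [CompleteSpace W]

/-- The curve `z ↦ exp(-z (σ + N)) v`. -/
def expCurve (σ : ℂ) (N : W →L[ℂ] W) (v : W) (z : ℂ) : W :=
  Complex.exp (-(σ * z)) • NormedSpace.exp (z • (-N)) v

theorem expCurve_add (σ : ℂ) (N : W →L[ℂ] W) (v : W) (z z' : ℂ) :
    expCurve σ N v (z + z') =
      Complex.exp (-(σ * z')) • NormedSpace.exp (z' • (-N)) (expCurve σ N v z) := by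
  let _ : NormedAlgebra ℚ (W →L[ℂ] W) := NormedAlgebra.restrictScalars ℚ ℂ _
  have hc : Commute (z' • (-N)) (z • (-N)) := ((Commute.refl (-N)).smul_left z').smul_right z
  rw [expCurve, expCurve, map_smul, smul_smul, ← Complex.exp_add, add_smul, add_comm (z • -N),
    NormedSpace.exp_add_of_commute hc, mul_add, neg_add, add_comm (-(σ * z))]
  rfl

theorem hasDerivAt_expCurve (σ : ℂ) (N : W →L[ℂ] W) (v : W) (z : ℂ) :
    HasDerivAt (expCurve σ N v) (-(σ • expCurve σ N v z) - expCurve σ N (N v) z) z := by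
  have h1 : HasDerivAt (fun z => NormedSpace.exp (z • (-N)) v)
      ((NormedSpace.exp (z • (-N)) * (-N)) v) z :=
    ((ContinuousLinearMap.apply ℂ W v).hasFDerivAt.comp_hasDerivAt z
      (hasDerivAt_exp_smul_const (-N) z))
  have h2 : HasDerivAt (fun z => Complex.exp (-(σ * z))) (Complex.exp (-(σ * z)) * (-σ)) z := by
    have : HasDerivAt (fun z => -(σ * z)) (-σ) z := (hasDerivAt_const_mul σ).neg
    exact this.cexp
  refine (h2.smul h1).congr_deriv ?_
  have h3 : (NormedSpace.exp (z • (-N)) * (-N)) v = -NormedSpace.exp (z • (-N)) (N v) := by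
    rw [← map_neg]; rfl
  rw [h3, expCurve, expCurve]
  module

theorem expCurve_injective (σ : ℂ) (N : W →L[ℂ] W) (z : ℂ) {v : W} (h : expCurve σ N v z = 0) :
    v = 0 := by
  let _ : NormedAlgebra ℚ (W →L[ℂ] W) := NormedAlgebra.restrictScalars ℚ ℂ _
  rw [expCurve, smul_eq_zero] at h
  obtain ⟨u, hu⟩ := NormedSpace.isUnit_exp (z • (-N))
  have h1 : ((↑u⁻¹ : W →L[ℂ] W) * u) v = v := by rw [Units.inv_mul]; rfl
  rw [← h1, mul_apply_eq_comp, hu, h.resolve_left (Complex.exp_ne_zero _), map_zero]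

/-- `z ↦ exp(-z (σ + N)) v` as a linear map of `v`. -/
def expLinear (σ : ℂ) (N : W →L[ℂ] W) (z : ℂ) : W →ₗ[ℂ] W where
  toFun v := expCurve σ N v z
  map_add' v w := by simp [expCurve]
  map_smul' c v := by simp [expCurve, smul_comm c]

/-- The logarithm of an operator `A` with the single eigenvalue `exp(σ T)`: there is a nilpotent `N`
with `A = exp(T (σ + N))`, which is stated in terms of the curves `exp(-z (σ + N)) v`. -/
theorem exists_log_of_isNilpotent_sub [FiniteDimensional ℂ W] {A : Module.End ℂ W} {T : ℝ}
    {μ σ : ℂ} (hA : IsNilpotent (A - μ • 1)) (hT : T ≠ 0) (hσ : Complex.exp (σ * T) = μ) :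
    ∃ N : W →L[ℂ] W, IsNilpotent (N : Module.End ℂ W) ∧
      LinearMap.ker (N : Module.End ℂ W) = LinearMap.ker (A - μ • 1) ∧
      ∀ v z, A (expCurve σ N v (z + T)) = expCurve σ N v z := by
  let _ : NormedAlgebra ℚ (W →L[ℂ] W) := NormedAlgebra.restrictScalars ℚ ℂ _
  have hμ : μ ≠ 0 := hσ ▸ Complex.exp_ne_zero _
  have hT' : (T : ℂ) ≠ 0 := by exact_mod_cast hT
  -- `A = μ (1 + x)`
  let x : W →L[ℂ] W := μ⁻¹ • LinearMap.toContinuousLinearMap (A - μ • 1)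
  have hx : IsNilpotent x := by
    obtain ⟨l, hl⟩ := hA
    refine ⟨l, ?_⟩
    rw [smul_pow]
    have : (LinearMap.toContinuousLinearMap (A - μ • 1)) ^ l = 0 := by
      apply ContinuousLinearMap.coe_injective
      rw [ContinuousLinearMap.toLinearMap_pow]
      exact hl
    rw [this, smul_zero]
  have hAx : ∀ w, A w = μ • (1 + x) w := by
    intro w
    show A w = μ • (w + μ⁻¹ • (A w - μ • w))
    rw [smul_add, smul_inv_smul₀ hμ]; abel
  obtain ⟨a, ha, ⟨c, hc⟩, ⟨c', hc'⟩, he⟩ := exists_exp_eq_one_add_of_isNilpotent hx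
  refine ⟨(T : ℂ)⁻¹ • a, ?_, ?_, fun v z => ?_⟩
  · obtain ⟨l, hl⟩ := ha
    refine ⟨l, ?_⟩
    rw [← ContinuousLinearMap.toLinearMap_pow, smul_pow, hl, smul_zero]
    rfl
  · ext w
    rw [LinearMap.mem_ker, LinearMap.mem_ker]
    have h1 : (T : ℂ)⁻¹ • a w = 0 ↔ a w = 0 := by simp [hT']
    have h2 : x w = 0 ↔ (A - μ • 1) w = 0 := by
      show μ⁻¹ • (A - μ • 1) w = 0 ↔ _
      simp [hμ]
    refine h1.trans (Iff.trans ⟨fun h0 => ?_, fun h0 => ?_⟩ h2)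
    · rw [hc']; show c' (a w) = 0; rw [h0, map_zero]
    · rw [hc]; show c (x w) = 0; rw [h0, map_zero]
  · rw [expCurve_add, map_smul, hAx]
    set u := expCurve σ ((T : ℂ)⁻¹ • a) v z
    have h1 : (T : ℂ) • -((T : ℂ)⁻¹ • a) = -a := by
      rw [smul_neg, smul_inv_smul₀ hT']
    have h2 : (1 + x) (NormedSpace.exp (-a) u) = u := by
      rw [← he]
      show (NormedSpace.exp a * NormedSpace.exp (-a)) u = u
      rw [← NormedSpace.exp_add_of_commute (Commute.neg_right rfl), add_neg_cancel,
        NormedSpace.exp_zero]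
      rfl
    rw [h1, h2, Complex.exp_neg, hσ, inv_smul_smul₀ hμ]

/-- The Floquet normal form: transporting the curves `exp(-τ (σ + N)) bᵢ` along a flow `Y` of
entire solutions gives solutions of the chain equations. -/
theorem solvesChain_expCurve {h : ℝ} [Fact (0 < h)] {V : Type*} [NormedAddCommGroup V]
    [NormedSpace ℂ V] [ProperSpace V] {L : ℝ → HistorySpace h V →L[ℂ] V} {k : ℕ}
    (hL : ContDiff ℝ k L) [FiniteDimensional ℂ W] (Y : W →ₗ[ℂ] C(ℝ, V))
    (hY : ∀ w, IsEntireSolution L (Y w)) (σ : ℂ) (N : W →L[ℂ] W) {m : ℕ}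
    (b : Module.Basis (Fin m) ℂ W) (heads : Finset (Fin m)) (h1 : ∀ i ∈ heads, N (b i) = 0)
    (h2 : ∀ i ∉ heads, N (b i) = b ⟨i - 1, (Nat.sub_le _ _).trans_lt i.2⟩) :
    (∀ i, ContDiff ℝ (k + 1 : ℕ) fun τ : ℝ => hist h (Y (expCurve σ N (b i) τ)) τ) ∧
      SolvesChain (fun τ => generator (L τ)) σ heads
        fun i τ => hist h (Y (expCurve σ N (b i) τ)) τ := by
  let Ψ : ℝ → W →ₗ[ℂ] HistorySpace h V := fun τ => (histLinear h V τ).comp Y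
  have hΨ : ∀ τ w, Ψ τ w = ∑ l, b.repr w l • hist h (Y (b l)) τ := by
    intro τ w
    conv_lhs => rw [← b.sum_repr w]
    rw [map_sum]
    exact Finset.sum_congr rfl fun l _ => map_smul _ _ _
  let φ : Fin m → ℝ → HistorySpace h V := fun i τ => Ψ τ (expCurve σ N (b i) τ)
  -- the coordinates of the exponential curves are entire functions of time
  let c : Fin m → Fin m → ℂ → ℂ := fun i l z => b.repr (expCurve σ N (b i) z) l
  have hc : ∀ i l z, HasDerivAt (c i l)
      (b.repr (-(σ • expCurve σ N (b i) z) - expCurve σ N (N (b i)) z) l) z := fun i l z =>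
    (LinearMap.toContinuousLinearMap (b.coord l)).hasFDerivAt.comp_hasDerivAt z
      (hasDerivAt_expCurve σ N (b i) z)
  have hcs : ∀ i l, ContDiff ℝ (k + 1 : ℕ) fun τ : ℝ => c i l τ := fun i l =>
    ((Differentiable.contDiff (n := (k + 1 : ℕ))
      fun z => (hc i l z).differentiableAt).restrict_scalars ℝ).comp Complex.ofRealCLM.contDiff
  have hφ : ∀ i, φ i = fun τ : ℝ => ∑ l, c i l τ • hist h (Y (b l)) τ := fun i =>
    funext fun τ => hΨ τ _
  have hflow : ∀ l, ContDiff ℝ (k + 1 : ℕ) (hist h (Y (b l))) := fun l =>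
    contDiff_hist ((hY (b l)).contDiff hL)
  refine ⟨fun i => ?_, fun i τ => ?_⟩
  · show ContDiff ℝ (k + 1 : ℕ) (φ i)
    rw [hφ]
    exact ContDiff.sum fun l _ => (hcs i l).smul (hflow l)
  · choose ψ hψ1 hψ2 using fun l => (hY (b l)).exists_hasDerivAt_hist hL.continuous τ
    refine ⟨_, ∑ l, c i l τ • ψ l, (HasDerivAt.fun_sum (u := Finset.univ) fun l _ =>
      ((hc i l τ).comp_ofReal.smul (hψ1 l))).congr_of_eventuallyEq
        (Eventually.of_forall fun τ => congrFun (hφ i) τ), ?_, ?_⟩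
    · show (φ i τ, _) ∈ generator (L τ)
      have h3 := sum_mem (t := Finset.univ) fun l _ =>
        (generator (L τ)).smul_mem (c i l τ) (hψ2 l)
      convert h3 using 1
      rw [hφ]
      ext1
      · simp [Prod.fst_sum]
      · simp [Prod.snd_sum]
    · rw [Finset.sum_add_distrib, add_sub_cancel_left, ← hΨ]
      have h3 : Ψ τ (-(σ • expCurve σ N (b i) τ) - expCurve σ N (N (b i)) τ) +
          σ • Ψ τ (expCurve σ N (b i) τ) = -Ψ τ (expLinear σ N τ (N (b i))) := by
        rw [map_sub, map_neg, map_smul]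
        show _ = -Ψ τ (expCurve σ N (N (b i)) τ)
        abel
      refine h3.trans ?_
      rw [chainRHS]
      split_ifs with hi
      · rw [h1 i hi, map_zero, map_zero, neg_zero]
      · rw [h2 i hi]
        rfl

/-- Floquet's theorem for an abstract flow `Y` of entire solutions over a finite-dimensional
space, on which translation by the period acts as an operator `A` with the single eigenvalue
`μ`. -/
theorem exists_floquet_chain {h : ℝ} [Fact (0 < h)] {V : Type*} [NormedAddCommGroup V]
    [NormedSpace ℂ V] [ProperSpace V] {L : ℝ → HistorySpace h V →L[ℂ] V} {k : ℕ}
    (hL : ContDiff ℝ k L) [FiniteDimensional ℂ W] {A : Module.End ℂ W} {T : ℝ} {μ σ : ℂ}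
    (hA : IsNilpotent (A - μ • 1)) (hT : T ≠ 0) (hσ : Complex.exp (σ * T) = μ)
    (Y : W →ₗ[ℂ] C(ℝ, V)) (hY : ∀ w, IsEntireSolution L (Y w))
    (hper : ∀ w τ, hist h (Y w) (τ + T) = hist h (Y (A w)) τ)
    (hinj : ∀ w τ, hist h (Y w) τ = 0 → w = 0) {m : ℕ} (hm : Module.finrank ℂ W = m) :
    ∃ (heads : Finset (Fin m)) (φ : Fin m → ℝ → HistorySpace h V),
      (∀ i : Fin m, (i : ℕ) = 0 → i ∈ heads) ∧
      heads.card = Module.finrank ℂ (LinearMap.ker (A - μ • 1)) ∧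
      (∀ i, IsSmoothPeriodic (k + 1) T (φ i)) ∧
      SolvesChain (fun τ => generator (L τ)) σ heads φ ∧
      ∀ τ, LinearIndependent ℂ (fun i => φ i τ) ∧ ∀ i, ∃ w, φ i τ = hist h (Y w) τ := by
  obtain ⟨N, hN, hker, hexp⟩ := exists_log_of_isNilpotent_sub hA hT hσ
  obtain ⟨heads, b, h0, h1, h2, hcard⟩ := exists_jordan_basis hN hm
  obtain ⟨hsmooth, hchain⟩ := solvesChain_expCurve hL Y hY σ N b heads h1 h2
  refine ⟨heads, _, h0, by rw [hcard, hker], fun i => ⟨hsmooth i, fun τ => ?_⟩, hchain,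
    fun τ => ⟨?_, fun i => ⟨_, rfl⟩⟩⟩
  · show hist h (Y (expCurve σ N (b i) (τ + T : ℝ))) (τ + T) = hist h (Y (expCurve σ N (b i) τ)) τ
    rw [hper, Complex.ofReal_add, hexp]
  · refine b.linearIndependent.map' (((histLinear h V τ).comp Y).comp (expLinear σ N τ)) ?_
    rw [LinearMap.ker_eq_bot']
    intro w hw
    exact expCurve_injective σ N τ (hinj _ τ hw)

/-- `exists_floquet_chain` for a parameter space without a norm. -/
theorem exists_floquet_chain_of_module {h : ℝ} [Fact (0 < h)] {V : Type*} [NormedAddCommGroup V]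
    [NormedSpace ℂ V] [ProperSpace V] {L : ℝ → HistorySpace h V →L[ℂ] V} {k : ℕ}
    (hL : ContDiff ℝ k L) {E : Type*} [AddCommGroup E] [Module ℂ E] [FiniteDimensional ℂ E]
    {A : Module.End ℂ E} {T : ℝ} {μ σ : ℂ}
    (hA : IsNilpotent (A - μ • 1)) (hT : T ≠ 0) (hσ : Complex.exp (σ * T) = μ)
    (Y : E →ₗ[ℂ] C(ℝ, V)) (hY : ∀ w, IsEntireSolution L (Y w))
    (hper : ∀ w τ, hist h (Y w) (τ + T) = hist h (Y (A w)) τ)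
    (hinj : ∀ w τ, hist h (Y w) τ = 0 → w = 0) {m : ℕ} (hm : Module.finrank ℂ E = m) :
    ∃ (heads : Finset (Fin m)) (φ : Fin m → ℝ → HistorySpace h V),
      (∀ i : Fin m, (i : ℕ) = 0 → i ∈ heads) ∧
      heads.card = Module.finrank ℂ (LinearMap.ker (A - μ • 1)) ∧
      (∀ i, IsSmoothPeriodic (k + 1) T (φ i)) ∧
      SolvesChain (fun τ => generator (L τ)) σ heads φ ∧
      ∀ τ, LinearIndependent ℂ (fun i => φ i τ) ∧ ∀ i, ∃ w, φ i τ = hist h (Y w) τ := by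
  let e : E ≃ₗ[ℂ] (Fin m → ℂ) := (Module.finBasisOfFinrankEq ℂ E hm).equivFun
  have hconj : e.conjAlgEquiv ℂ A - μ • 1 = e.conjAlgEquiv ℂ (A - μ • 1) := by
    rw [map_sub, map_smul, map_one]
  have hker : LinearMap.ker (e.conjAlgEquiv ℂ (A - μ • 1)) =
      (LinearMap.ker (A - μ • 1)).map (e : E →ₗ[ℂ] (Fin m → ℂ)) := by
    ext w
    rw [Submodule.mem_map_equiv, LinearMap.mem_ker, LinearMap.mem_ker]
    exact e.map_eq_zero_iff
  obtain ⟨heads, φ, h0, hcard, hsmooth, hchain, hbasis⟩ :=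
    exists_floquet_chain (W := Fin m → ℂ) (A := e.conjAlgEquiv ℂ A) hL
      (hconj ▸ hA.map (e.conjAlgEquiv ℂ)) hT hσ
      (Y.comp (e.symm : (Fin m → ℂ) →ₗ[ℂ] E)) (fun w => hY _)
      (fun w τ => (hper (e.symm w) τ).trans (by
        show _ = hist h (Y (e.symm (e (A (e.symm w))))) τ
        rw [e.symm_apply_apply]))
      (fun w τ hw => e.symm.map_eq_zero_iff.1 (hinj _ τ hw)) (Module.finrank_fin_fun ℂ)
  refine ⟨heads, φ, h0, ?_, hsmooth, hchain, fun τ => ⟨(hbasis τ).1, fun i => ?_⟩⟩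
  · rw [hcard, hconj, hker, LinearEquiv.finrank_map_eq]
  · obtain ⟨w, hw⟩ := (hbasis τ).2 i
    exact ⟨e.symm w, hw⟩

end Exponential

/-! ### Generalized eigenspaces of the period maps -/

section FloquetBasis

set_option linter.unusedSectionVars false

variable {h : ℝ} [Fact (0 < h)] {V : Type*} [NormedAddCommGroup V] [NormedSpace ℂ V]
  [ProperSpace V] {L : ℝ → HistorySpace h V →L[ℂ] V} {M T : ℝ} {μ σ : ℂ}

/-- The generalized eigenspace at `μ` of the period map `U(τ + T, τ)`. -/
abbrev floquetSpace (L : ℝ → HistorySpace h V →L[ℂ] V) (T : ℝ) (μ : ℂ) (τ : ℝ) :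
    Submodule ℂ (HistorySpace h V) :=
  Module.End.maxGenEigenspace (evolution L (τ + T) τ).toLinearMap μ

/-- The period map has a compact power, so Riesz theory applies to it. -/
theorem finiteDimensional_floquetSpace (hL : Continuous L) (hM : ∀ t, ‖L t‖ ≤ M) (hT : 0 < T)
    (hper : Function.Periodic L T) (hμ : μ ≠ 0) (τ : ℝ) :
    FiniteDimensional ℂ (floquetSpace L T μ τ) := by
  have hh : (0 : ℝ) < h := Fact.out
  -- the `j`-th power of the period map is the solution operator over the time `j T > h`
  obtain ⟨j, hj⟩ := exists_nat_gt (h / T)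
  have hj0 : j ≠ 0 := by
    rintro rfl
    have : 0 < h / T := by positivity
    simp only [Nat.cast_zero] at hj
    linarith
  rw [div_lt_iff₀ hT] at hj
  refine finiteDimensional_maxGenEigenspace_of_pow (N := j) ?_ hμ
  rw [evolution_pow hL hM hT hper τ j hj0]
  exact isCompactOperator_evolution hL hM (by linarith)

/-- The period map is invertible on its generalized eigenspaces at `μ ≠ 0`. -/
theorem exists_periodMap_equiv (hμ : μ ≠ 0) (s : ℝ)
    [FiniteDimensional ℂ (floquetSpace L T μ s)] :
    ∃ A : floquetSpace L T μ s ≃ₗ[ℂ] floquetSpace L T μ s,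
      ∀ w, (A w : HistorySpace h V) = evolution L (s + T) s w := by
  set P : Module.End ℂ (HistorySpace h V) := (evolution L (s + T) s).toLinearMap
  have hmaps : ∀ x ∈ floquetSpace L T μ s, P x ∈ floquetSpace L T μ s :=
    Module.End.mapsTo_maxGenEigenspace_of_comm (Commute.refl P) μ
  have hinj : Function.Injective (P.restrict hmaps) := by
    rw [injective_iff_map_eq_zero]
    rintro ⟨w, hw⟩ hPw
    have hPw' : P w = 0 := congrArg Subtype.val hPw
    obtain ⟨l, hl⟩ := (Module.End.mem_maxGenEigenspace _ _ _).1 hw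
    have h1 : ∀ l : ℕ, ((P - μ • 1) ^ l) w = (-μ) ^ l • w := by
      intro l
      induction l with
      | zero => simp
      | succ l ih =>
        rw [pow_succ', Module.End.mul_apply, ih, map_smul, LinearMap.sub_apply, hPw']
        simp [pow_succ, mul_smul]
    rw [h1, smul_eq_zero] at hl
    exact Subtype.ext (hl.resolve_left (pow_ne_zero _ (neg_ne_zero.2 hμ)))
  exact ⟨LinearEquiv.ofInjectiveEndo _ hinj, fun w => rfl⟩

/-- A flow of entire solutions through the generalized eigenspace at time `s` on which the period
map acts as `A`. -/
structure IsFloquetFlow (L : ℝ → HistorySpace h V →L[ℂ] V) (T : ℝ) (μ : ℂ) (s : ℝ)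
    (A : floquetSpace L T μ s ≃ₗ[ℂ] floquetSpace L T μ s)
    (Y : floquetSpace L T μ s →ₗ[ℂ] C(ℝ, V)) : Prop where
  periodMap : ∀ w, (A w : HistorySpace h V) = evolution L (s + T) s w
  entire : ∀ w, IsEntireSolution L (Y w)
  init : ∀ w, hist h (Y w) s = w
  period : ∀ w t, Y w (t + T) = Y (A w) t

theorem exists_isFloquetFlow (hL : Continuous L) (hM : ∀ t, ‖L t‖ ≤ M) (hT : 0 < T)
    (hper : Function.Periodic L T) (hμ : μ ≠ 0) (s : ℝ) :
    ∃ A Y, IsFloquetFlow L T μ s A Y := by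
  have := finiteDimensional_floquetSpace hL hM hT hper hμ s
  obtain ⟨A, hA⟩ := exists_periodMap_equiv (L := L) (T := T) hμ s
  obtain ⟨Y, h1, h2, h3⟩ := exists_floquet_flow hL hM hT hper s (floquetSpace L T μ s) A hA
  exact ⟨A, Y, hA, h1, h2, h3⟩

section Flow

variable {s : ℝ} {A : floquetSpace L T μ s ≃ₗ[ℂ] floquetSpace L T μ s}
  {Y : floquetSpace L T μ s →ₗ[ℂ] C(ℝ, V)}

theorem IsFloquetFlow.hist_add_period (hY : IsFloquetFlow L T μ s A Y) (w) (τ : ℝ) :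
    hist h (Y w) (τ + T) = hist h (Y (A w)) τ := by
  rw [← hist_translate]
  congr 1
  ext t
  exact hY.period w t

theorem IsFloquetFlow.evolution_hist (hY : IsFloquetFlow L T μ s A Y) (hL : Continuous L)
    (hM : ∀ t, ‖L t‖ ≤ M) (hT : 0 < T) (w) (τ : ℝ) :
    evolution L (τ + T) τ (hist h (Y w) τ) = hist h (Y (A w)) τ := by
  rw [evolution_eq hL hM (by linarith) ((hY.entire w).isSolution τ), hY.hist_add_period]

/-- The operators `A - μ` and `U(s + T, s) - μ` have the same powers on the generalized
eigenspace. -/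
theorem IsFloquetFlow.pow_sub_apply (hY : IsFloquetFlow L T μ s A Y) (w) (l : ℕ) :
    ((((A : Module.End ℂ (floquetSpace L T μ s)) - μ • 1) ^ l) w : HistorySpace h V) =
      (((evolution L (s + T) s).toLinearMap -
        μ • (1 : Module.End ℂ (HistorySpace h V))) ^ l) w := by
  induction l with
  | zero => rfl
  | succ l ih =>
    rw [pow_succ', pow_succ', Module.End.mul_apply, Module.End.mul_apply, ← ih]
    show ((A _ - μ • _ : floquetSpace L T μ s) : HistorySpace h V) = _
    rw [Submodule.coe_sub, hY.periodMap]
    rfl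

/-- The flow carries the generalized eigenspace at time `s` into the one at time `τ`, as it
intertwines `A` with the period map at `τ`. -/
theorem IsFloquetFlow.hist_mem (hY : IsFloquetFlow L T μ s A Y) (hL : Continuous L)
    (hM : ∀ t, ‖L t‖ ≤ M) (hT : 0 < T) (w) (τ : ℝ) :
    hist h (Y w) τ ∈ floquetSpace L T μ τ := by
  have h1 : ∀ l : ℕ, (((evolution L (τ + T) τ).toLinearMap - μ • 1) ^ l) (hist h (Y w) τ) =
      hist h (Y ((((A : Module.End ℂ (floquetSpace L T μ s)) - μ • 1) ^ l) w)) τ := by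
    intro l
    induction l with
    | zero => rfl
    | succ l ih =>
      rw [pow_succ', pow_succ', Module.End.mul_apply, Module.End.mul_apply, ih]
      set w' := (((A : Module.End ℂ (floquetSpace L T μ s)) - μ • 1) ^ l) w
      show evolution L (τ + T) τ (hist h (Y w') τ) - μ • hist h (Y w') τ =
        histLinear h V τ (Y (A w' - μ • w'))
      rw [hY.evolution_hist hL hM hT, map_sub, map_sub, map_smul, map_smul]
      rfl
  obtain ⟨l, hl⟩ := (Module.End.mem_maxGenEigenspace _ _ _).1 w.2
  refine (Module.End.mem_maxGenEigenspace _ _ _).2 ⟨l, ?_⟩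
  have h2 : (((A : Module.End ℂ (floquetSpace L T μ s)) - μ • 1) ^ l) w = 0 :=
    Subtype.ext ((hY.pow_sub_apply w l).trans hl)
  rw [h1, h2, map_zero]
  rfl

/-- The flow is injective at each time `τ`: if `y = Y w` has `y_τ = 0`, then also
`y_(s + jT) = A ^ j w` vanishes for large `j`, and `A` is invertible. -/
theorem IsFloquetFlow.eq_zero_of_hist (hY : IsFloquetFlow L T μ s A Y) (hL : Continuous L)
    (hM : ∀ t, ‖L t‖ ≤ M) (hT : 0 < T) {w} {τ : ℝ} (h0 : hist h (Y w) τ = 0) : w = 0 := by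
  have h1 : ∀ (j : ℕ) w, hist h (Y w) (s + j * T) =
      (((A : Module.End ℂ (floquetSpace L T μ s)) ^ j) w : floquetSpace L T μ s) := by
    intro j
    induction j with
    | zero => intro w; simpa using hY.init w
    | succ j ih =>
      intro w
      rw [pow_succ, Module.End.mul_apply, show s + ((j + 1 : ℕ) : ℝ) * T = s + j * T + T by
        push_cast; ring, hY.hist_add_period, ih]
      rfl
  obtain ⟨j, hj⟩ := exists_nat_gt ((τ - s) / T)
  rw [div_lt_iff₀ hT] at hj
  have h2 := evolution_eq hL hM (show τ ≤ s + j * T by linarith) ((hY.entire w).isSolution τ)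
  rw [h0, map_zero, h1] at h2
  have h3 : ((A : Module.End ℂ (floquetSpace L T μ s)) ^ j) w = 0 := Subtype.ext h2.symm
  have h4 : Function.Injective ⇑((A : Module.End ℂ (floquetSpace L T μ s)) ^ j) := by
    rw [Module.End.coe_pow]
    exact A.injective.iterate j
  exact h4 (h3.trans (map_zero _).symm)

theorem IsFloquetFlow.isNilpotent_sub (hY : IsFloquetFlow L T μ s A Y)
    [FiniteDimensional ℂ (floquetSpace L T μ s)] :
    IsNilpotent ((A : Module.End ℂ (floquetSpace L T μ s)) - μ • 1) := by
  rw [Module.End.isNilpotent_iff_of_finite]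
  intro w
  obtain ⟨l, hl⟩ := (Module.End.mem_maxGenEigenspace _ _ _).1 w.2
  exact ⟨l, Subtype.ext ((hY.pow_sub_apply w l).trans hl)⟩

theorem IsFloquetFlow.finrank_ker (hY : IsFloquetFlow L T μ s A Y) :
    Module.finrank ℂ (LinearMap.ker ((A : Module.End ℂ (floquetSpace L T μ s)) - μ • 1)) =
      Module.finrank ℂ (Module.End.eigenspace (evolution L (s + T) s).toLinearMap μ) := by
  rw [← Submodule.finrank_map_subtype_eq]
  suffices Submodule.map (floquetSpace L T μ s).subtype
      (LinearMap.ker ((A : Module.End ℂ (floquetSpace L T μ s)) - μ • 1)) =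
      Module.End.eigenspace (evolution L (s + T) s).toLinearMap μ by rw [this]
  ext x
  rw [Submodule.mem_map, Module.End.mem_eigenspace_iff]
  constructor
  · rintro ⟨w, hw, rfl⟩
    have h1 : A w - μ • w = 0 := hw
    have h2 := congrArg Subtype.val (sub_eq_zero.1 h1)
    rwa [hY.periodMap] at h2
  · intro hx
    refine ⟨⟨x, Module.End.eigenspace_le_maxGenEigenspace (Module.End.mem_eigenspace_iff.2 hx)⟩,
      ?_, rfl⟩
    show A _ - μ • _ = 0
    refine sub_eq_zero.2 (Subtype.ext ?_)
    rw [hY.periodMap]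
    exact hx

end Flow

/-- By symmetry in `s` and `τ`, the algebraic multiplicity does not depend on the time. -/
theorem finrank_floquetSpace_le (hL : Continuous L) (hM : ∀ t, ‖L t‖ ≤ M) (hT : 0 < T)
    (hper : Function.Periodic L T) (hμ : μ ≠ 0) (s τ : ℝ) :
    Module.finrank ℂ (floquetSpace L T μ s) ≤ Module.finrank ℂ (floquetSpace L T μ τ) := by
  have := finiteDimensional_floquetSpace hL hM hT hper hμ τ
  obtain ⟨A, Y, hY⟩ := exists_isFloquetFlow hL hM hT hper hμ s
  refine LinearMap.finrank_le_finrank_of_injective (f := ((histLinear h V τ).comp Y).codRestrict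
    (floquetSpace L T μ τ) fun w => hY.hist_mem hL hM hT w τ) ?_
  rw [injective_iff_map_eq_zero]
  intro w hw
  exact hY.eq_zero_of_hist hL hM hT (congrArg Subtype.val hw)

/-- Floquet's theorem for periodic linear delay equations: the generalized eigenspaces of the period
maps at `μ = exp(σ T)` have periodic bases that solve the chain equations. -/
theorem exists_floquet_basis {k : ℕ} (hL : ContDiff ℝ k L) (hM : ∀ t, ‖L t‖ ≤ M) (hT : 0 < T)
    (hper : Function.Periodic L T) (s : ℝ) (hσ : Complex.exp (σ * T) = μ) {m : ℕ}
    (hm : Module.finrank ℂ (floquetSpace L T μ s) = m) :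
    ∃ (heads : Finset (Fin m)) (φ : Fin m → ℝ → HistorySpace h V),
      (∀ i : Fin m, (i : ℕ) = 0 → i ∈ heads) ∧
      heads.card =
        Module.finrank ℂ (Module.End.eigenspace (evolution L (s + T) s).toLinearMap μ) ∧
      (∀ i, IsSmoothPeriodic (k + 1) T (φ i)) ∧
      SolvesChain (fun τ => generator (L τ)) σ heads φ ∧
      ∀ τ, LinearIndependent ℂ (fun i => φ i τ) ∧
        Submodule.span ℂ (Set.range fun i => φ i τ) = floquetSpace L T μ τ := by
  have hLc : Continuous L := hL.continuous
  have hμ : μ ≠ 0 := hσ ▸ Complex.exp_ne_zero _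
  have hfd := finiteDimensional_floquetSpace hLc hM hT hper hμ
  have := hfd s
  obtain ⟨A, Y, hY⟩ := exists_isFloquetFlow hLc hM hT hper hμ s
  obtain ⟨heads, φ, h0, hcard, hsmooth, hchain, hbasis⟩ :=
    exists_floquet_chain_of_module (E := floquetSpace L T μ s) hL hY.isNilpotent_sub hT.ne' hσ Y
      hY.entire hY.hist_add_period (fun w τ => hY.eq_zero_of_hist hLc hM hT) hm
  refine ⟨heads, φ, h0, hcard.trans hY.finrank_ker, hsmooth, hchain, fun τ => ?_⟩
  have hli := (hbasis τ).1
  -- the span lies in the generalized eigenspace at `τ` and has at least its dimension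
  refine ⟨hli, ?_⟩
  have := hfd τ
  refine Submodule.eq_of_le_of_finrank_le ?_ ?_
  · rw [Submodule.span_le]
    rintro _ ⟨i, rfl⟩
    obtain ⟨w, hw⟩ := (hbasis τ).2 i
    show φ i τ ∈ floquetSpace L T μ τ
    rw [hw]
    exact hY.hist_mem hLc hM hT _ τ
  · refine (finrank_floquetSpace_le hLc hM hT hper hμ τ s).trans ?_
    rw [hm]
    exact ((finrank_span_eq_card hli).trans (Fintype.card_fin m)).ge

end FloquetBasis

end

end DelayEq

/-! ### Floquet chains along a periodic solution -/

theorem mainTheorem1 (n k : ℕ) (hk : 1 ≤ k) (h : ℝ) [Fact (0 < h)]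
    (F : HistorySpace h (EuclideanSpace ℝ (Fin n)) → EuclideanSpace ℝ (Fin n))
    (hF : ContDiff ℝ (k + 1) F)
    (γ : C(ℝ, EuclideanSpace ℝ (Fin n))) (T : ℝ) (hγ : IsPeriodicSolution F γ T)
    (s : ℝ) (μ σ : ℂ) (hμ : IsFloquetMultiplier F γ T μ s) (hσ : Complex.exp (σ * T) = μ) :
    (∃ (heads : Finset (Fin (algMult F γ T μ s)))
        (φ : Fin (algMult F γ T μ s) → ℝ → HistorySpace h (EuclideanSpace ℂ (Fin n))),
      (∀ i : Fin (algMult F γ T μ s), (i : ℕ) = 0 → i ∈ heads) ∧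
      heads.card = geomMult F γ T μ s ∧
      (∀ i, IsSmoothPeriodic (k + 1) T (φ i)) ∧
      SolvesChain (fun τ => sunStarGenerator (linearization F γ τ)) σ heads
        (fun i τ => sunEmbedding (shiftSemigroup h (EuclideanSpace ℂ (Fin n))) (φ i τ)) ∧
      SolvesChain (fun τ => generator (linearization F γ τ)) σ heads φ ∧
      ∀ τ, LinearIndependent ℂ (fun i => φ i τ) ∧
        Submodule.span ℂ (Set.range fun i => φ i τ) = genEigenspace F γ T μ τ) ∧
    (∀ (heads : Finset (Fin (algMult F γ T μ s)))
        (φ : Fin (algMult F γ T μ s) → ℝ → HistorySpace h (EuclideanSpace ℂ (Fin n))),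
      (∀ i : Fin (algMult F γ T μ s), (i : ℕ) = 0 → i ∈ heads) →
      (∀ i, IsSmoothPeriodic (k + 1) T (φ i)) →
      (SolvesChain (fun τ => sunStarGenerator (linearization F γ τ)) σ heads
          (fun i τ => sunEmbedding (shiftSemigroup h (EuclideanSpace ℂ (Fin n))) (φ i τ)) ↔
        SolvesChain (fun τ => generator (linearization F γ τ)) σ heads φ)) := by
  have hF1 : ContDiff ℝ 1 F := hF.of_le le_add_self
  obtain ⟨M, hM⟩ := linearization_bounded hF1 hγ
  have hdiff {φ : Fin (algMult F γ T μ s) → ℝ → HistorySpace h (EuclideanSpace ℂ (Fin n))}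
      (hφ : ∀ i, IsSmoothPeriodic (k + 1) T (φ i)) (i) : Differentiable ℝ (φ i) :=
    (hφ i).1.differentiable (by exact_mod_cast k.succ_ne_zero)
  refine ⟨?_, fun heads φ _ hφ => solvesChain_sunStar_iff _ σ heads (hdiff hφ)⟩
  obtain ⟨heads, φ, h0, hcard, hsmooth, hchain, hbasis⟩ :=
    exists_floquet_basis (contDiff_linearization hF hγ) hM hγ.minimal.1.1
      (linearization_periodic hγ) s hσ (m := algMult F γ T μ s) rfl
  exact ⟨heads, φ, h0, hcard, hsmooth,
    (solvesChain_sunStar_iff _ σ heads (hdiff hsmooth)).2 hchain, hchain, hbasis⟩
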